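/- Let $n\ge 2$. Let $V_1,\dots,V_s\subset\mathbb{R}^n$ be finitely many closed convex polyhedra of dimension $n-1$, any two of which intersect in a common (possibly empty) face, and for each $i$ let $v_i\neq 0$ be a normal vector of $V_i$; write $v_i^*=d(v_i\cdot x)$. Consider the $(1,1)$-super current $$T=\sum_{i}[V_i]\wedge J(v_i^*),$$ where $[V_i]$ is the current of integration on $V_i$ oriented by $v_i$ (a basis $b$ of the hyperplane $v_i^{\perp}$ is positive when $(v_i,b)$ is a positive basis of $\mathbb{R}^n$), and $J(dx_k)=d\xi_k$. Explicitly, $T$ acts on smooth compactly supported $(n-1,n-1)$-forms $\alpha=\sum\alpha_{KL}(x)\,dx_K\wedge d\xi_L$ by $\langle T,\alpha\rangle=\sum_i\int_{V_i\times\mathbb{R}^n}J(v_i^*)\wedge\alpha$, where $\int_{V\times\mathbb{R}^n}\sum_I\eta_I\,dx_I\wedge d\xi_1\wedge\dots\wedge d\xi_n=\sum_I\int_V\eta_I\,dx_I$, and $\langle dT,\beta\rangle=\pm\langle T,d\beta\rangle$ for $(n-2,n-1)$-forms $\beta$, with $d$ the exterior derivative in the $x$-variables. Then $dT=0$ if and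 only if the following balancing condition holds: for every $(n-2)$-dimensional face $W$ of one of the $V_i$, if $V_{i_1},\dots,V_{i_m}$ ($m\ge1$) are all the polyhedra containing $W$, and the signs of their normal vectors are chosen so that they all induce the same orientation on $W$, then $$\sum_{j=1}^m v_{i_j}=0.$$ Here the choice of signs means: fix a basis $(e_1,\dots,e_{n-2})$ of the direction space of $W$, let $w_{i_j}$ be the unit normal of $W$ pointing into $V_{i_j}$, and choose the sign of $v_{i_j}$ so that $(v_{i_j},w_{i_j},e_1,\dots,e_{n-2})$ is a positively oriented basis of $\mathbb{R}^n$. In particular, the equivalence holds for the tropical hypersurface of every tropical polynomial $f(x)=\max_{\alpha\in A}(-\nu(\alpha)+\alpha\cdot x)$, $A\subset\mathbb{Z}^n$ finite and nonempty, $\nu:A\to\mathbb{R}$, where the $V_i$ are the $(n-1)$-dimensional intersections of two of the $n$-dimensional regions on which a single affine function $-\nu(\alpha)+\alpha\cdot x$ attains the maximum, and $v_i=\alpha_1-\alpha_2$ for the two corresponding exponents. -/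

import Mathlib

open Set MeasureTheory Module
open scoped Distributions

noncomputable section

namespace SuperCurrent

/-! ### Operations on test functions with values in a normed space -/

section Generic

variable {V F G : Type*} [NormedAddCommGroup V] [NormedSpace ℝ V] [NormedAddCommGroup F]
  [NormedSpace ℝ F] [NormedAddCommGroup G] [NormedSpace ℝ G]

/-- Test functions (smooth, compactly supported) on all of `V` with values in `F`. -/
abbrev Test (V F : Type*) [NormedAddCommGroup V] [NormedSpace ℝ V] [NormedAddCommGroup F]
    [NormedSpace ℝ F] : Type _ := 𝓓((⊤ : TopologicalSpace.Opens V), F)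

/-- Composition of test functions with a continuous linear map. -/
def postcomp (L : F →L[ℝ] G) : Test V F →L[ℝ] Test V G := TestFunction.postcompCLM L

theorem postcomp_apply (L : F →L[ℝ] G) (α : Test V F) (x : V) : postcomp L α x = L (α x) := rfl

/-- The exterior derivative of compactly supported smooth `p`-forms. -/
def extD (p : ℕ) : Test V (V [⋀^Fin p]→L[ℝ] F) →L[ℝ] Test V (V [⋀^Fin (p + 1)]→L[ℝ] F) :=
  (postcomp (ContinuousAlternatingMap.alternatizeUncurryFinCLM ℝ V F)).comp
    (TestFunction.fderivCLM ℝ ⊤ ⊤)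

theorem extD_apply (p : ℕ) (α : Test V (V [⋀^Fin p]→L[ℝ] F)) (x : V) :
    extD p α x = extDeriv (⇑α) x := by
  simp [extD, extDeriv, postcomp_apply]

/-- The functional `α ↦ ∫ L (α x) dμ(x)`, for a locally finite measure `μ`. -/
def integralFunctional [MeasurableSpace V] [BorelSpace V] (μ : Measure V) (L : F →L[ℝ] ℝ) :
    Test V F →L[ℝ] ℝ :=
  (TestFunction.integralAgainstBilinCLM (ContinuousLinearMap.mul ℝ ℝ) μ fun _ => (1 : ℝ)).comp
    (postcomp L)

theorem integralFunctional_apply [MeasurableSpace V] [BorelSpace V] (μ : Measure V)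
    [IsLocallyFiniteMeasure μ] (L : F →L[ℝ] ℝ) (α : Test V F) :
    integralFunctional μ L α = ∫ x, L (α x) ∂μ := by
  have h : LocallyIntegrableOn (fun _ : V => (1 : ℝ)) ((⊤ : TopologicalSpace.Opens V) : Set V) μ :=
    (locallyIntegrable_const 1).locallyIntegrableOn _
  simp only [integralFunctional, ContinuousLinearMap.comp_apply]
  rw [TestFunction.integralAgainstBilinCLM_eq_integral h]
  simp [postcomp_apply]

end Generic

/-! ### Super forms and super currents -/

/-- The space `𝕍 = ℝⁿ` with its Euclidean inner product. The second copy `𝕎` is identified with it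
via `J`, so `E n` is used for both. -/
abbrev E (n : ℕ) : Type := EuclideanSpace ℝ (Fin n)

/-- Covectors of bidegree `(p, q)`: `∑ a_{KL} dx_K ∧ dξ_L` is the alternating `p`-form in the
`x`-directions, with values in the alternating `q`-forms in the `ξ`-directions,
`∑ a_{KL} dx_K ⊗ dξ_L`. -/
abbrev SuperCovector (n p q : ℕ) : Type := E n [⋀^Fin p]→L[ℝ] (E n [⋀^Fin q]→L[ℝ] ℝ)

/-- `𝓓^{p,q}`: smooth compactly supported forms of bidegree `(p, q)` whose coefficients depend
on `x` only. -/
abbrev TestForm (n p q : ℕ) : Type := Test (E n) (SuperCovector n p q)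

/-- Currents of bidimension `(p, q)`, that is, of bidegree `(n - p, n - q)`: the topological dual
of `𝓓^{p,q}`. -/
abbrev Current (n p q : ℕ) : Type := TestForm n p q →L[ℝ] ℝ

/-- The operator `d : 𝓓^{p,q} → 𝓓^{p+1,q}`, the exterior derivative in the `x`-variables. -/
def dForm (n p q : ℕ) : TestForm n p q →L[ℝ] TestForm n (p + 1) q := extD p

/-- The operator `d` on currents, `⟨dT, α⟩ = (-1)^{deg T + 1} ⟨T, dα⟩`; a current of bidimension
`(p + 1, q)` has degree `(n - p - 1) + (n - q)`. -/
def Current.d {n p q : ℕ} (T : Current n (p + 1) q) : Current n p q :=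
  (-1 : ℝ) ^ (p + q) • T.comp (dForm n p q)

/-- The wedge product `l ∧ β` of a covector `l` and an alternating `q`-form `β`. -/
def wedgeCovector {n : ℕ} (q : ℕ) (l : E n →L[ℝ] ℝ) :
    (E n [⋀^Fin q]→L[ℝ] ℝ) →L[ℝ] (E n [⋀^Fin (q + 1)]→L[ℝ] ℝ) :=
  (ContinuousAlternatingMap.alternatizeUncurryFinCLM ℝ (E n) ℝ).comp
    (ContinuousLinearMap.smulRightL ℝ (E n) (E n [⋀^Fin q]→L[ℝ] ℝ) l)

theorem wedgeCovector_apply {n q : ℕ} (l : E n →L[ℝ] ℝ) (β : E n [⋀^Fin q]→L[ℝ] ℝ)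
    (u : Fin (q + 1) → E n) :
    wedgeCovector q l β u = ∑ i : Fin (q + 1), (-1 : ℝ) ^ (i : ℕ) * (l (u i) * β (i.removeNth u)) := by
  simp [wedgeCovector, ContinuousAlternatingMap.alternatizeUncurryFin_apply, zsmul_eq_mul]

/-- The wedge product `J(l) ∧ η` of the `(0, 1)`-covector `J(l)` with a `(p, q)`-covector `η`:
moving `J(l)` past the `p` factors `dx` produces the sign `(-1)^p`. -/
def wedgeJ {n : ℕ} (p q : ℕ) (l : E n →L[ℝ] ℝ) :
    SuperCovector n p q →L[ℝ] SuperCovector n p (q + 1) :=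
  (-1 : ℝ) ^ p •
    ContinuousLinearMap.compContinuousAlternatingMapCLM ℝ (E n) _ _ (Fin p) (wedgeCovector q l)

theorem wedgeJ_apply {n p q : ℕ} (l : E n →L[ℝ] ℝ) (η : SuperCovector n p q) (u : Fin p → E n) :
    wedgeJ p q l η u = (-1 : ℝ) ^ p • wedgeCovector q l (η u) := rfl

/-- The current `T ∧ J(l)`, defined by `⟨T ∧ J(l), α⟩ = ⟨T, J(l) ∧ α⟩`. -/
def Current.wedgeJ {n p q : ℕ} (T : Current n p (q + 1)) (l : E n →L[ℝ] ℝ) : Current n p q :=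
  T.comp (postcomp (SuperCurrent.wedgeJ p q l))

/-! ### Integration over oriented pieces of hyperplanes -/

/-- The determinant of `n` vectors in `ℝⁿ`; they form a positively oriented basis iff it is
positive. -/
def det {n : ℕ} (u : Fin n → E n) : ℝ := (EuclideanSpace.basisFun (Fin n) ℝ).toBasis.det u

/-- `b` is an orthonormal basis of the hyperplane `v^⊥` which is positively oriented for the
orientation that the normal vector `v` induces: `(v, b)` is positively oriented in `ℝⁿ`. -/
structure IsOrientedFrame {k : ℕ} (v : E (k + 1)) (b : Fin k → E (k + 1)) : Prop where
  orthonormal : Orthonormal ℝ b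
  orthogonal : ∀ i, inner ℝ v (b i) = 0
  pos : 0 < det (Matrix.vecCons v b)

theorem exists_isOrientedFrame {m : ℕ} (v : E (m + 2)) (hv : v ≠ 0) :
    ∃ b, IsOrientedFrame v b := by
  have hfr : finrank ℝ (Submodule.span ℝ {v})ᗮ = m + 1 := by
    have h := Submodule.finrank_add_finrank_orthogonal (Submodule.span ℝ {v})
    rw [finrank_span_singleton hv, finrank_euclideanSpace_fin] at h
    omega
  obtain ⟨b, hb, hperp⟩ : ∃ b : Fin (m + 1) → E (m + 2), Orthonormal ℝ b ∧
      ∀ i, inner ℝ v (b i) = 0 := by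
    let B := (stdOrthonormalBasis ℝ (Submodule.span ℝ {v})ᗮ).reindex (finCongr hfr)
    refine ⟨fun i => (B i : E (m + 2)), ?_, fun i => ?_⟩
    · exact B.orthonormal.comp_linearIsometry (Submodule.span ℝ {v})ᗮ.subtypeₗᵢ
    · exact (Submodule.mem_orthogonal_singleton_iff_inner_right).1 (B i).2
  have hli : LinearIndependent ℝ (Matrix.vecCons v b) := by
    rw [Matrix.vecCons, linearIndependent_finCons]
    refine ⟨hb.linearIndependent, fun hmem => hv ?_⟩
    have : v ∈ (Submodule.span ℝ {v})ᗮ := by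
      refine Submodule.span_le.2 ?_ hmem
      rintro _ ⟨i, rfl⟩
      exact (Submodule.mem_orthogonal_singleton_iff_inner_right).2 (hperp i)
    exact inner_self_eq_zero.1 ((Submodule.mem_orthogonal_singleton_iff_inner_right).1 this)
  have hdet : det (Matrix.vecCons v b) ≠ 0 := by
    have : IsUnit ((EuclideanSpace.basisFun (Fin (m + 2)) ℝ).toBasis.det (Matrix.vecCons v b)) := by
      rw [← Basis.is_basis_iff_det]
      refine ⟨hli, ?_⟩
      exact hli.span_eq_top_of_card_eq_finrank (by simp)
    exact this.ne_zero
  rcases hdet.lt_or_gt with h | h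
  · refine ⟨Function.update b 0 (-b 0), ?_, ?_, ?_⟩
    · refine ⟨fun i => ?_, fun i j hij => ?_⟩
      · rcases eq_or_ne i 0 with rfl | hi
        · simp [hb.1 0]
        · simp [Function.update_of_ne hi, hb.1 i]
      · have h0 := hb.2 hij
        rcases eq_or_ne i 0 with rfl | hi
        · simpa [Function.update_of_ne hij.symm] using h0
        · rcases eq_or_ne j 0 with rfl | hj
          · simpa [Function.update_of_ne hi] using h0
          · simpa [Function.update_of_ne hi, Function.update_of_ne hj] using h0
    · intro i
      rcases eq_or_ne i 0 with rfl | hi <;> simp_all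
    · have h1 : Matrix.vecCons v (Function.update b 0 (-b 0)) =
          Function.update (Matrix.vecCons v b) 1 (-b 0) := by
        simp [Matrix.vecCons]
      have h2 : det (Function.update (Matrix.vecCons v b) 1 (-b 0)) =
          - det (Matrix.vecCons v b) := by
        have := ((EuclideanSpace.basisFun (Fin (m + 2)) ℝ).toBasis.det).map_update_neg
          (Matrix.vecCons v b) 1 (b 0)
        rw [det, this, det]
        congr 2
        conv_rhs => rw [← Function.update_eq_self 1 (Matrix.vecCons v b)]
        rfl
      rw [h1, h2]
      linarith
  · exact ⟨b, hb, hperp, h⟩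

open Classical in
/-- A choice of oriented orthonormal frame of `v^⊥`; the value of an alternating form of top degree
on it does not depend on the choice. -/
def orientedFrame {k : ℕ} (v : E (k + 1)) : Fin k → E (k + 1) :=
  if h : ∃ b, IsOrientedFrame v b then h.choose else 0

theorem isOrientedFrame_orientedFrame {m : ℕ} (v : E (m + 2)) (hv : v ≠ 0) :
    IsOrientedFrame v (orientedFrame v) := by
  rw [orientedFrame, dif_pos (exists_isOrientedFrame v hv)]
  exact (exists_isOrientedFrame v hv).choose_spec

/-- The coefficient of `(vol_{v^⊥}) ∧ dξ_1 ∧ … ∧ dξ_n` in the restriction to `v^⊥` of a covector of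
bidegree `(n - 1, n)`. -/
def hyperplaneCoeff {k : ℕ} (v : E (k + 1)) : SuperCovector (k + 1) k (k + 1) →L[ℝ] ℝ :=
  (ContinuousAlternatingMap.apply ℝ (E (k + 1)) ℝ
      (EuclideanSpace.basisFun (Fin (k + 1)) ℝ)).comp
    (ContinuousAlternatingMap.apply ℝ (E (k + 1)) (E (k + 1) [⋀^Fin (k + 1)]→L[ℝ] ℝ)
      (orientedFrame v))

theorem hyperplaneCoeff_apply {k : ℕ} (v : E (k + 1)) (η : SuperCovector (k + 1) k (k + 1)) :
    hyperplaneCoeff v η = η (orientedFrame v) (EuclideanSpace.basisFun (Fin (k + 1)) ℝ) := rfl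

/-- The current of integration `[P]` over a piece `P` of a hyperplane with normal vector `v`,
oriented by `v`: `⟨[P], η⟩ = ∫_{P × 𝕎} η` for `(n - 1, n)`-forms `η`, where
`∫_{P × 𝕎} ∑ η_I dx_I ∧ dξ_1 ∧ … ∧ dξ_n = ∑ ∫_P η_I dx_I`. The integral over `P` is with respect to
the surface measure, i.e. the `(n - 1)`-dimensional Euclidean Hausdorff measure. -/
def integrationCurrent {k : ℕ} (P : Set (E (k + 1))) (v : E (k + 1)) :
    Current (k + 1) k (k + 1) :=
  integralFunctional ((Measure.euclideanHausdorffMeasure k).restrict P) (hyperplaneCoeff v)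

theorem isLocallyFiniteMeasure_restrict {n k : ℕ} (P : Set (E n))
    (hP : finrank ℝ (vectorSpan ℝ P) = k) :
    IsLocallyFiniteMeasure ((Measure.euclideanHausdorffMeasure k).restrict P) := by
  rcases P.eq_empty_or_nonempty with rfl | hne
  · rw [Measure.restrict_empty]; infer_instance
  have : Nonempty (affineSpan ℝ P) := ((affineSpan_nonempty ℝ).2 hne).to_subtype
  have hdir : finrank ℝ (affineSpan ℝ P).direction = k := by rw [direction_affineSpan, hP]
  suffices IsFiniteMeasureOnCompacts ((Measure.euclideanHausdorffMeasure k).restrict P) from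
    inferInstance
  refine ⟨fun K hK => ?_⟩
  have hsub : K ∩ P ⊆ Subtype.val '' ((Subtype.val : affineSpan ℝ P → E n) ⁻¹' K) := by
    rintro x ⟨hxK, hxP⟩
    exact ⟨⟨x, subset_affineSpan ℝ P hxP⟩, hxK, rfl⟩
  have hK' : IsCompact ((Subtype.val : affineSpan ℝ P → E n) ⁻¹' K) := by
    have hcl : IsClosed ((affineSpan ℝ P : AffineSubspace ℝ (E n)) : Set (E n)) :=
      AffineSubspace.closed_of_finiteDimensional _
    exact hcl.isClosedEmbedding_subtypeVal.isCompact_preimage hK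
  rw [Measure.restrict_apply hK.measurableSet]
  refine (measure_mono hsub).trans_lt ?_
  rw [AffineSubspace.euclideanHausdorffMeasure_coe_image, ← hdir]
  let p : affineSpan ℝ P := Classical.arbitrary _
  have hmp := EuclideanGeometry.measurePreserving_vaddConst p
  rw [← hmp.measure_preimage hK'.measurableSet.nullMeasurableSet]
  exact IsCompact.measure_lt_top
    ((IsometryEquiv.vaddConst p).toHomeomorph.isCompact_preimage.2 hK')

theorem integrationCurrent_apply {k : ℕ} (P : Set (E (k + 1))) (v : E (k + 1))
    (hP : finrank ℝ (vectorSpan ℝ P) = k) (η : TestForm (k + 1) k (k + 1)) :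
    integrationCurrent P v η =
      ∫ x in P, η x (orientedFrame v) (EuclideanSpace.basisFun (Fin (k + 1)) ℝ)
        ∂(Measure.euclideanHausdorffMeasure k) := by
  have := isLocallyFiniteMeasure_restrict P hP
  rw [integrationCurrent, integralFunctional_apply]
  rfl

/-! ### Polyhedral hypersurfaces -/

/-- A closed convex polyhedron: the intersection of finitely many closed half-spaces. -/
def IsPolyhedron {n : ℕ} (P : Set (E n)) : Prop :=
  ∃ s : Set (E n × ℝ), s.Finite ∧ P = {x | ∀ a ∈ s, inner ℝ a.1 x ≤ a.2}

/-- A hypersurface in `ℝ^{m+2}` consisting of finitely many (`ι` is finite in use) closed convex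
polyhedra `V_i` of dimension `m + 1`, any two of which meet along a common (possibly empty) face,
together with a nonzero normal vector `v_i` of each `V_i`. -/
structure PolyhedralHypersurface (ι : Type*) (m : ℕ) where
  /-- the polyhedra `V_i` -/
  cell : ι → Set (E (m + 2))
  /-- the normal vectors `v_i` -/
  normal : ι → E (m + 2)
  isPolyhedron_cell : ∀ i, IsPolyhedron (cell i)
  finrank_cell : ∀ i, finrank ℝ (vectorSpan ℝ (cell i)) = m + 1
  isExposed_inter : ∀ i j, IsExposed ℝ (cell i) (cell i ∩ cell j)
  normal_ne_zero : ∀ i, normal i ≠ 0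
  normal_orthogonal : ∀ i, ∀ x ∈ cell i, ∀ y ∈ cell i, inner ℝ (normal i) (x - y) = 0

namespace PolyhedralHypersurface

variable {ι : Type*} {m : ℕ}

/-- The current `T = ∑ [V_i] ∧ J(v_i^*)` with `v_i^* = d(v_i · x)`, of bidegree `(1, 1)`. -/
def current [Fintype ι] (X : PolyhedralHypersurface ι m) : Current (m + 2) (m + 1) (m + 1) :=
  ∑ i, (integrationCurrent (X.cell i) (X.normal i)).wedgeJ (innerSL ℝ (X.normal i))

theorem current_apply [Fintype ι] (X : PolyhedralHypersurface ι m)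
    (α : TestForm (m + 2) (m + 1) (m + 1)) :
    X.current α = ∑ i, ∫ x in X.cell i,
      wedgeJ (m + 1) (m + 1) (innerSL ℝ (X.normal i)) (α x) (orientedFrame (X.normal i))
        (EuclideanSpace.basisFun (Fin (m + 2)) ℝ)
        ∂(Measure.euclideanHausdorffMeasure (m + 1)) := by
  rw [current, _root_.sum_apply]
  refine Finset.sum_congr rfl fun i _ => ?_
  rw [Current.wedgeJ, ContinuousLinearMap.comp_apply,
    integrationCurrent_apply _ _ (X.finrank_cell i)]
  rfl

theorem d_current_eq_zero_iff [Fintype ι] (X : PolyhedralHypersurface ι m) :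
    X.current.d = 0 ↔ ∀ α : TestForm (m + 2) m (m + 1), X.current (dForm _ _ _ α) = 0 := by
  have h : ((-1 : ℝ) ^ (m + (m + 1))) ≠ 0 := pow_ne_zero _ (by norm_num)
  constructor
  · intro h0 α
    have := congrArg (fun T : Current (m + 2) m (m + 1) => T α) h0
    simpa [Current.d, h] using this
  · intro h0
    ext α
    simp [Current.d, h0 α]

/-- `W` is one of the codimension two cells of the hypersurface: an `m`-dimensional face of some
`V_i`. -/
def IsRidge (X : PolyhedralHypersurface ι m) (W : Set (E (m + 2))) : Prop :=
  W.Nonempty ∧ finrank ℝ (vectorSpan ℝ W) = m ∧ ∃ i, IsExposed ℝ (X.cell i) W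

end PolyhedralHypersurface

/-- `w` is the unit normal of `W` pointing into `V`. -/
def IsInwardUnitNormal {n : ℕ} (V W : Set (E n)) (w : E n) : Prop :=
  ‖w‖ = 1 ∧ (∀ x ∈ W, ∀ y ∈ W, inner ℝ w (x - y) = 0) ∧ ∃ x ∈ W, ∃ t : ℝ, 0 < t ∧ x + t • w ∈ V

/-- `u` is the one of the two vectors `v`, `-v` for which `(u, w, e_1, …, e_m)` is positively
oriented, where `w` is the unit normal of `W` pointing into `V`. -/
def IsCompatibleNormal {m : ℕ} (V W : Set (E (m + 2))) (e : Fin m → E (m + 2))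
    (v u : E (m + 2)) : Prop :=
  (u = v ∨ u = -v) ∧
    ∃ w, IsInwardUnitNormal V W w ∧ 0 < det (Matrix.vecCons u (Matrix.vecCons w e))

open Classical in
/-- The balancing condition: for every codimension two cell `W`, every basis `e` of (the direction
space of) `W`, and the choice of signs `u_i = ± v_i` for which all `V_i ⊇ W` induce on `W` the
orientation of `e`, one has `∑ u_i = 0`, the sum being over all `i` with `V_i ⊇ W`. -/
def PolyhedralHypersurface.Balanced {ι : Type*} [Fintype ι] {m : ℕ}
    (X : PolyhedralHypersurface ι m) : Prop :=
  ∀ W, X.IsRidge W →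
    ∀ e : Fin m → E (m + 2), LinearIndependent ℝ e →
      Submodule.span ℝ (range e) = vectorSpan ℝ W →
    ∀ u : ι → E (m + 2),
      (∀ i, W ⊆ X.cell i → IsCompatibleNormal (X.cell i) W e (X.normal i) (u i)) →
      ∑ i with W ⊆ X.cell i, u i = 0

/-! ### Tropical hypersurfaces -/

/-- A tropical polynomial `f(x) = max_{α ∈ A} (-ν(α) + α · x)`, for a finite nonempty set
`A ⊆ ℤⁿ` (only the values of `ν` on `A` matter). -/
structure TropicalPolynomial (n : ℕ) where
  A : Finset (Fin n → ℤ)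
  nonempty : A.Nonempty
  ν : (Fin n → ℤ) → ℝ

/-- An integer vector as an element of `ℝⁿ`. -/
def toReal {n : ℕ} (α : Fin n → ℤ) : E n := WithLp.toLp 2 fun j => (α j : ℝ)

theorem toReal_injective {n : ℕ} : Function.Injective (toReal (n := n)) := by
  intro α β h
  funext j
  have := congrArg (fun x : E n => x j) h
  simpa [toReal] using this

namespace TropicalPolynomial

variable {n : ℕ} (f : TropicalPolynomial n)

/-- The affine function `-ν(α) + α · x`. -/
def term (α : Fin n → ℤ) (x : E n) : ℝ := -f.ν α + inner ℝ (toReal α) x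

/-- The value `f(x)`. -/
def eval (x : E n) : ℝ := f.A.sup' f.nonempty fun α => f.term α x

/-- The set where the affine function of exponent `α` attains the maximum. -/
def region (α : Fin n → ℤ) : Set (E n) := {x | f.term α x = f.eval x}

/-- The index set of the facets of the tropical hypersurface: pairs of exponents whose affine
functions each equal `f` on a set with nonempty interior, and which attain the maximum
simultaneously on a set of dimension `n - 1`. Of the pairs `(α, β)` and `(β, α)` only one is kept,
by means of the lexicographic order. -/
def Facet : Type :=
  {p : f.A × f.A // toLex (p.1 : Fin n → ℤ) < toLex (p.2 : Fin n → ℤ) ∧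
    (interior (f.region p.1)).Nonempty ∧ (interior (f.region p.2)).Nonempty ∧
    finrank ℝ (vectorSpan ℝ (f.region p.1 ∩ f.region p.2)) + 1 = n}

instance : Fintype f.Facet := by
  classical
  unfold Facet
  exact Fintype.ofFinite _

theorem term_le_eval {α : Fin n → ℤ} (hα : α ∈ f.A) (x : E n) : f.term α x ≤ f.eval x :=
  Finset.le_sup' (fun α => f.term α x) hα

theorem mem_region_iff {α : Fin n → ℤ} (hα : α ∈ f.A) (x : E n) :
    x ∈ f.region α ↔ ∀ γ ∈ f.A, f.term γ x ≤ f.term α x := by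
  constructor
  · intro h γ hγ
    rw [show f.term α x = f.eval x from h]
    exact f.term_le_eval hγ x
  · intro h
    exact le_antisymm (f.term_le_eval hα x) (Finset.sup'_le _ _ fun γ hγ => h γ hγ)

theorem isPolyhedron_region {α : Fin n → ℤ} (hα : α ∈ f.A) : IsPolyhedron (f.region α) := by
  refine ⟨(fun γ => (toReal γ - toReal α, f.ν γ - f.ν α)) '' (f.A : Set (Fin n → ℤ)),
    f.A.finite_toSet.image _, ?_⟩
  ext x
  rw [f.mem_region_iff hα]
  simp only [mem_ofPred_eq, forall_mem_image, Finset.mem_coe]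
  refine forall₂_congr fun γ _ => ?_
  simp only [term, inner_sub_left]
  constructor <;> intro h <;> linarith

theorem isPolyhedron_inter {P Q : Set (E n)} (hP : IsPolyhedron P) (hQ : IsPolyhedron Q) :
    IsPolyhedron (P ∩ Q) := by
  obtain ⟨s, hs, rfl⟩ := hP
  obtain ⟨t, ht, rfl⟩ := hQ
  refine ⟨s ∪ t, hs.union ht, ?_⟩
  ext x
  simp only [mem_inter_iff, mem_ofPred_eq, mem_union]
  exact ⟨fun h a ha => ha.elim (h.1 a) (h.2 a), fun h => ⟨fun a ha => h a (Or.inl ha),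
    fun a ha => h a (Or.inr ha)⟩⟩

theorem isExposed_region_inter {α β γ δ : Fin n → ℤ} (hγ : γ ∈ f.A) (hδ : δ ∈ f.A) :
    IsExposed ℝ (f.region α ∩ f.region β)
      (f.region α ∩ f.region β ∩ (f.region γ ∩ f.region δ)) := by
  rintro ⟨x₀, ⟨hx₀α, hx₀β⟩, hx₀γ, hx₀δ⟩
  refine ⟨innerSL ℝ (toReal γ + toReal δ - toReal α - toReal β), ?_⟩
  have key : ∀ x, x ∈ f.region α ∩ f.region β →
      inner ℝ (toReal γ + toReal δ - toReal α - toReal β) x =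
        (f.term γ x - f.eval x) + (f.term δ x - f.eval x)
          + (f.ν γ + f.ν δ - f.ν α - f.ν β) := by
    rintro x ⟨h1, h2⟩
    change f.term α x = f.eval x at h1
    change f.term β x = f.eval x at h2
    simp only [inner_sub_left, inner_add_left]
    simp only [term] at *
    linarith
  ext x
  constructor
  · rintro ⟨hx, hxγ, hxδ⟩
    refine ⟨hx, fun y hy => ?_⟩
    change f.term γ x = f.eval x at hxγ
    change f.term δ x = f.eval x at hxδ
    simp only [innerSL_apply_apply]
    rw [key x hx, key y hy]
    have := f.term_le_eval hγ y
    have := f.term_le_eval hδ y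
    linarith
  · rintro ⟨hx, hmax⟩
    have h := hmax x₀ ⟨hx₀α, hx₀β⟩
    change f.term γ x₀ = f.eval x₀ at hx₀γ
    change f.term δ x₀ = f.eval x₀ at hx₀δ
    simp only [innerSL_apply_apply] at h
    rw [key x hx, key x₀ ⟨hx₀α, hx₀β⟩] at h
    have h1 := f.term_le_eval hγ x
    have h2 := f.term_le_eval hδ x
    refine ⟨hx, ?_, ?_⟩
    · change f.term γ x = f.eval x
      linarith
    · change f.term δ x = f.eval x
      linarith

/-- The tropical hypersurface of `f`, with its facets `V` and the normal vectors `v = α - β`, where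
`α` and `β` are the exponents whose affine functions agree and attain the maximum on `V`. -/
def hypersurface {m : ℕ} (f : TropicalPolynomial (m + 2)) :
    PolyhedralHypersurface f.Facet m where
  cell p := f.region p.1.1 ∩ f.region p.1.2
  normal p := toReal p.1.1 - toReal p.1.2
  isPolyhedron_cell p := isPolyhedron_inter (f.isPolyhedron_region p.1.1.2)
    (f.isPolyhedron_region p.1.2.2)
  finrank_cell p := by
    have := p.2.2.2.2
    omega
  isExposed_inter p q := f.isExposed_region_inter q.1.1.2 q.1.2.2
  normal_ne_zero p := by
    rw [sub_ne_zero]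
    intro h
    have h' := p.2.1
    rw [toReal_injective h] at h'
    exact lt_irrefl _ h'
  normal_orthogonal p x hx y hy := by
    have h1 : f.term p.1.1 x = f.term p.1.2 x := Eq.trans hx.1 (Eq.symm hx.2)
    have h2 : f.term p.1.1 y = f.term p.1.2 y := Eq.trans hy.1 (Eq.symm hy.2)
    simp only [term] at h1 h2
    simp only [inner_sub_left, inner_sub_right]
    linarith

end TropicalPolynomial

end SuperCurrent

end

/-!
The current `T` pairs with a form `d(φ π^*vol ∧ β)`, for a linear map `π` onto `ℝ^m`, a scalar test
function `φ` and a constant form `β` in the `ξ`-directions, by integration over the fibres of `π`,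
and in the fibres everything is one-dimensional.

A cell `V_i` is mapped by `π` onto a set with interior only if the hyperplane `v_i^⊥` is mapped
onto `ℝ^m`; in that case `v_i^⊥` meets the fibres of `π` in lines, and in linear coordinates
`(t, y)` adapted to these lines `d(φ π^*vol)` restricts to `∂_t φ dt ∧ dy`
(`setIntegral_hyperplane`, `alternatizeUncurryFin_smulRight_pullbackVolume`). The line over `y`
meets `V_i` in an interval, so the fundamental theorem of calculus leaves the values of `φ` at its
endpoints (`integral_cell_eq_integral_fiber`). Collecting the cells that end at the same point `p`,
one finds `⟨T, d(φ π^*vol ∧ β)⟩ = ± ∫ ∑_{π p = y} φ(p) ⟨N(p), β⟩ dy`, where `N(p)` is a signed sum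
of the normals of these cells (`current_dForm_eq_integral_vertexSum`).

Almost every fibre meets only those faces that `π` maps onto sets with interior
(`ae_map_linealitySpace`). In such a fibre a cell can end only in the relative interior of a ridge
`W` that projects isomorphically to `ℝ^m`. Since the cells meet along common faces, all cells
through `p` then contain `W`, and the sign that a cell gets in `N(p)` is, up to a common factor
`-1`, the sign with which it induces a fixed orientation on `W` (`isCompatibleNormal_iff_eq`). Hence
`N(p) = -∑ u_i`, with the sum of the balancing condition (`IsRidgePoint.vertexSum_eq`).

If the balancing condition holds, then `N` vanishes on almost every fibre. Forms of the above kind,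
with coordinate projections `π`, span all forms (`testForm_eq_sum`), so `dT = 0`. Conversely, let
`dT = 0` and let `p` be a relative interior point of a ridge `W`. Near `p`, the vector `N` is
constant on `W` and vanishes elsewhere (`IsRidgePoint.eventually_vertexSum`); with a bump function
`φ` at `p` and a projection `π` adapted to `W`, the formula shows that `⟨N(p), β⟩ = 0` for all `β`,
so `N(p) = 0`.

The local geometry of the cells is expressed by the cone of feasible directions at a point and its
lineality space, the direction space of the smallest face through the point.
-/

open scoped Topology

namespace SuperCurrent

/-! ### Feasible directions of convex sets -/

section Feasible

variable {V : Type*} [AddCommGroup V] [Module ℝ V] {P : Set V} {p d d' : V}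

/-- The cone of feasible directions of `P` at `p`: the directions in which one can move from `p` by
a positive amount and end in `P`. For convex `P` this is the tangent cone before taking the
closure. -/
def feasibleCone (P : Set V) (p : V) : Set V := {d | ∃ ε : ℝ, 0 < ε ∧ p + ε • d ∈ P}

theorem smul_mem_feasibleCone {c : ℝ} (hc : 0 < c) (hd : d ∈ feasibleCone P p) :
    c • d ∈ feasibleCone P p := by
  obtain ⟨ε, hε, h⟩ := hd
  refine ⟨ε / c, by positivity, ?_⟩
  rwa [smul_smul, div_mul_cancel₀ _ hc.ne']

theorem add_mem_feasibleCone (hP : Convex ℝ P) (hd : d ∈ feasibleCone P p)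
    (hd' : d' ∈ feasibleCone P p) : d + d' ∈ feasibleCone P p := by
  obtain ⟨ε, hε, h⟩ := hd
  obtain ⟨δ, hδ, h'⟩ := hd'
  refine ⟨ε * δ / (ε + δ), by positivity, ?_⟩
  have hs : δ / (ε + δ) + ε / (ε + δ) = 1 := by field_simp; ring
  convert hP h h' (a := δ / (ε + δ)) (b := ε / (ε + δ)) (by positivity) (by positivity) hs using 1
  match_scalars <;> field_simp
  ring

theorem sub_mem_feasibleCone {x : V} (hx : x ∈ P) : x - p ∈ feasibleCone P p :=
  ⟨1, one_pos, by simpa using hx⟩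

/-- The lineality space of the cone of feasible directions: the directions in which one can move
from `p` both ways without leaving `P`. It is the direction space of the smallest face of `P` that
contains `p`. -/
def linealitySpace (hP : Convex ℝ P) (hp : p ∈ P) : Submodule ℝ V where
  carrier := {d | d ∈ feasibleCone P p ∧ -d ∈ feasibleCone P p}
  add_mem' {a b} ha hb := ⟨add_mem_feasibleCone hP ha.1 hb.1, by
    rw [neg_add]; exact add_mem_feasibleCone hP ha.2 hb.2⟩
  zero_mem' := by
    have : (0 : V) ∈ feasibleCone P p := ⟨1, one_pos, by simpa using hp⟩
    simpa using this
  smul_mem' c d hd := by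
    rcases lt_trichotomy c 0 with hc | rfl | hc
    · have h1 := smul_mem_feasibleCone (neg_pos.2 hc) hd.2
      have h2 := smul_mem_feasibleCone (neg_pos.2 hc) hd.1
      simp only [smul_neg, neg_smul, neg_neg] at h1 h2
      exact ⟨h1, h2⟩
    · have : (0 : V) ∈ feasibleCone P p := ⟨1, one_pos, by simpa using hp⟩
      simpa using this
    · refine ⟨smul_mem_feasibleCone hc hd.1, ?_⟩
      rw [← smul_neg]
      exact smul_mem_feasibleCone hc hd.2

theorem mem_linealitySpace {hP : Convex ℝ P} {hp : p ∈ P} :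
    d ∈ linealitySpace hP hp ↔ d ∈ feasibleCone P p ∧ -d ∈ feasibleCone P p := Iff.rfl

theorem add_mem_feasibleCone_iff (hP : Convex ℝ P) (hp : p ∈ P) {z : V}
    (hz : z ∈ linealitySpace hP hp) : d + z ∈ feasibleCone P p ↔ d ∈ feasibleCone P p := by
  refine ⟨fun h => ?_, fun h => add_mem_feasibleCone hP h hz.1⟩
  simpa using add_mem_feasibleCone hP h hz.2

/-- An extreme subset through `p` contains all segments of the ambient set with `p` in their
interior. -/
theorem mem_feasibleCone_of_isExtreme {Q : Set V} (hQ : IsExtreme ℝ P Q) (hp : p ∈ Q)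
    (hd : d ∈ feasibleCone P p) (hd' : -d ∈ feasibleCone P p) :
    d ∈ feasibleCone Q p := by
  obtain ⟨ε, hε, h⟩ := hd
  obtain ⟨δ, hδ, h'⟩ := hd'
  refine ⟨ε, hε, hQ.left_mem_of_mem_openSegment h h' hp ?_⟩
  have hs : δ / (ε + δ) + ε / (ε + δ) = 1 := by field_simp; ring
  refine ⟨δ / (ε + δ), ε / (ε + δ), by positivity, by positivity, hs, ?_⟩
  rw [smul_add, smul_add, add_add_add_comm, ← add_smul, hs, one_smul, smul_smul, smul_smul,
    smul_neg, add_eq_left, ← sub_eq_add_neg, ← sub_smul]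
  rw [show δ / (ε + δ) * ε - ε / (ε + δ) * δ = 0 by ring, zero_smul]

theorem linealitySpace_mono {Q : Set V} (hQ : Convex ℝ Q) (hp : p ∈ Q) (hP : Convex ℝ P)
    (h : Q ⊆ P) : linealitySpace hQ hp ≤ linealitySpace hP (h hp) := by
  rintro d ⟨⟨ε, hε, h1⟩, ⟨δ, hδ, h2⟩⟩
  exact ⟨⟨ε, hε, h h1⟩, ⟨δ, hδ, h h2⟩⟩

theorem linealitySpace_eq_of_isExtreme {Q : Set V} (hQ : IsExtreme ℝ P Q) (hQc : Convex ℝ Q)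
    (hp : p ∈ Q) (hP : Convex ℝ P) :
    linealitySpace hP (hQ.1 hp) = linealitySpace hQc hp := by
  refine le_antisymm (fun d hd => ⟨mem_feasibleCone_of_isExtreme hQ hp hd.1 hd.2,
    mem_feasibleCone_of_isExtreme hQ hp hd.2 (by simpa using hd.1)⟩) ?_
  exact linealitySpace_mono hQc hp hP hQ.1

theorem feasibleCone_subset_vectorSpan (hp : p ∈ P) :
    feasibleCone P p ⊆ (vectorSpan ℝ P : Set V) := by
  rintro d ⟨ε, hε, h⟩
  have := vsub_mem_vectorSpan ℝ h hp
  simp only [vsub_eq_sub, add_sub_cancel_left] at this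
  exact ((vectorSpan ℝ P).smul_mem_iff hε.ne').1 this

theorem vectorSpan_le_of_sub_mem (hp : p ∈ P) {U : Submodule ℝ V} (h : ∀ x ∈ P, x - p ∈ U) :
    vectorSpan ℝ P ≤ U := by
  rw [vectorSpan_eq_span_vsub_set_right ℝ hp, Submodule.span_le]
  rintro _ ⟨x, hx, rfl⟩
  exact h x hx

end Feasible

/-! ### The local structure of a polyhedron -/

section Polyhedron

variable {n : ℕ}

/-- The half-spaces among `s` that have `p` on their boundary. -/
def activeConstraints (s : Set (E n × ℝ)) (p : E n) : Set (E n × ℝ) :=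
  {a ∈ s | inner ℝ a.1 p = a.2}

/-- Near a point of a polyhedron, only the active constraints matter: the polyhedron coincides with
a cone. -/
theorem eventually_mem_iff_activeConstraints {s : Set (E n × ℝ)} (hs : s.Finite) {p : E n}
    (hp : ∀ a ∈ s, inner ℝ a.1 p ≤ a.2) :
    ∀ᶠ x in 𝓝 p, (∀ a ∈ s, inner ℝ a.1 x ≤ a.2) ↔
      ∀ a ∈ activeConstraints s p, inner ℝ a.1 (x - p) ≤ 0 := by
  have h : ∀ᶠ x in 𝓝 p, ∀ a ∈ s \ activeConstraints s p, inner ℝ a.1 x < a.2 := by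
    rw [Filter.eventually_all_finite (hs.subset sdiff_subset)]
    rintro a ⟨ha, hna⟩
    have hlt : inner ℝ a.1 p < a.2 := lt_of_le_of_ne (hp a ha) fun h => hna ⟨ha, h⟩
    have hc : Continuous fun x : E n => (inner ℝ a.1 x : ℝ) := by fun_prop
    exact hc.continuousAt.eventually_lt continuousAt_const hlt
  filter_upwards [h] with x hx
  constructor
  · intro h a ha
    rw [inner_sub_right, ha.2]
    linarith [h a ha.1]
  · intro h a ha
    by_cases hact : a ∈ activeConstraints s p
    · have := h a hact
      rw [inner_sub_right, hact.2] at this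
      linarith
    · exact (hx a ⟨ha, hact⟩).le

theorem mem_feasibleCone_iff_activeConstraints {s : Set (E n × ℝ)} (hs : s.Finite) {p : E n}
    (hp : ∀ a ∈ s, inner ℝ a.1 p ≤ a.2) {d : E n} :
    d ∈ feasibleCone {x | ∀ a ∈ s, inner ℝ a.1 x ≤ a.2} p ↔
      ∀ a ∈ activeConstraints s p, inner ℝ a.1 d ≤ 0 := by
  constructor
  · rintro ⟨ε, hε, h⟩ a ha
    have := h a ha.1
    rw [inner_add_right, ha.2, inner_smul_right] at this
    by_contra! hlt
    nlinarith
  · intro h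
    have hc : ContinuousAt (fun t : ℝ => p + t • d) 0 := by fun_prop
    have ht : Filter.Tendsto (fun t : ℝ => p + t • d) (𝓝[>] 0) (𝓝 p) := by
      have := hc.tendsto
      simp only [zero_smul, add_zero] at this
      exact this.mono_left nhdsWithin_le_nhds
    obtain ⟨t, ht1, ht0⟩ := ((ht.eventually (eventually_mem_iff_activeConstraints hs hp)).and
      self_mem_nhdsWithin).exists
    refine ⟨t, ht0, ht1.2 fun a ha => ?_⟩
    rw [add_sub_cancel_left, inner_smul_right]
    exact mul_nonpos_of_nonneg_of_nonpos (le_of_lt ht0) (h a ha)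

theorem IsPolyhedron.convex {P : Set (E n)} (hP : IsPolyhedron P) : Convex ℝ P := by
  obtain ⟨s, -, rfl⟩ := hP
  have : {x : E n | ∀ a ∈ s, inner ℝ a.1 x ≤ a.2} = ⋂ a ∈ s, {x | innerₛₗ ℝ a.1 x ≤ a.2} := by
    ext; simp
  rw [this]
  exact convex_iInter₂ fun a _ => convex_halfSpace_le (innerₛₗ ℝ a.1).isLinear a.2

theorem IsPolyhedron.isClosed {P : Set (E n)} (hP : IsPolyhedron P) : IsClosed P := by
  obtain ⟨s, -, rfl⟩ := hP
  simp only [ofPred_forall]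
  exact isClosed_biInter fun a _ => isClosed_le (by fun_prop) continuous_const

theorem mem_linealitySpace_iff_activeConstraints {s : Set (E n × ℝ)} (hs : s.Finite) {p d : E n}
    (hP : Convex ℝ {x : E n | ∀ a ∈ s, inner ℝ a.1 x ≤ a.2})
    (hp : ∀ a ∈ s, inner ℝ a.1 p ≤ a.2) :
    d ∈ linealitySpace hP hp ↔ ∀ a ∈ activeConstraints s p, inner ℝ a.1 d = 0 := by
  rw [mem_linealitySpace, mem_feasibleCone_iff_activeConstraints hs hp,
    mem_feasibleCone_iff_activeConstraints hs hp, ← forall₂_and]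
  simp only [inner_neg_right, Left.neg_nonpos_iff, le_antisymm_iff]

/-- Near one of its points, a polyhedron coincides with the translate of its cone of feasible
directions. -/
theorem IsPolyhedron.eventually_mem_iff {P : Set (E n)} (hP : IsPolyhedron P) {p : E n}
    (hp : p ∈ P) : ∀ᶠ x in 𝓝 p, x ∈ P ↔ x - p ∈ feasibleCone P p := by
  obtain ⟨s, hs, rfl⟩ := hP
  filter_upwards [eventually_mem_iff_activeConstraints hs hp] with x hx
  rw [mem_feasibleCone_iff_activeConstraints hs hp]
  exact hx

/-- The smallest face through `p` is exposed: the sum of the active constraints at `p` attains its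
maximum exactly there. -/
theorem IsPolyhedron.isExposed_linealitySpace {P : Set (E n)} (hP : IsPolyhedron P) {p : E n}
    (hp : p ∈ P) : IsExposed ℝ P {x ∈ P | x - p ∈ linealitySpace hP.convex hp} := by
  obtain ⟨s, hs, rfl⟩ := hP
  intro _
  have hfin : (activeConstraints s p).Finite := hs.subset (sep_subset _ _)
  refine ⟨∑ a ∈ hfin.toFinset, innerSL ℝ a.1, ?_⟩
  have key : ∀ x, (∀ a ∈ s, inner ℝ a.1 x ≤ a.2) →
      ((∑ a ∈ hfin.toFinset, innerSL ℝ a.1) p ≤ (∑ a ∈ hfin.toFinset, innerSL ℝ a.1) x ↔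
        ∀ a ∈ activeConstraints s p, inner ℝ a.1 (x - p) = 0) := by
    intro x hx
    have hle : ∀ a ∈ hfin.toFinset, (inner ℝ a.1 x : ℝ) ≤ inner ℝ a.1 p := by
      intro a ha
      rw [hfin.mem_toFinset] at ha
      rw [ha.2]
      exact hx a ha.1
    simp only [_root_.sum_apply, innerSL_apply_apply]
    rw [(Finset.sum_le_sum hle).ge_iff_eq', eq_comm, Finset.sum_eq_sum_iff_of_le hle]
    simp only [hfin.mem_toFinset, inner_sub_right, sub_eq_zero]
  ext x
  simp only [mem_ofPred_eq, mem_linealitySpace_iff_activeConstraints hs]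
  refine and_congr_right fun hx => ?_
  rw [← key x hx]
  refine ⟨fun h y hy => le_trans ?_ h, fun h => h p hp⟩
  simp only [_root_.sum_apply, innerSL_apply_apply]
  refine Finset.sum_le_sum fun a ha => ?_
  rw [hfin.mem_toFinset] at ha
  rw [ha.2]
  exact hy a ha.1

end Polyhedron

/-! ### Determinants of vectors -/

section Alternating

variable {V : Type*} [AddCommGroup V] [Module ℝ V] {k : ℕ}

theorem map_vecCons_of_mem_span (f : V [⋀^Fin (k + 1)]→ₗ[ℝ] ℝ) (e : Fin k → V) {z : V}
    (hz : z ∈ Submodule.span ℝ (range e)) : f (Matrix.vecCons z e) = 0 := by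
  refine f.map_linearDependent _ fun h => ?_
  rw [Matrix.vecCons, linearIndependent_finCons] at h
  exact h.2 hz

theorem map_vecCons_add_of_mem_span (f : V [⋀^Fin (k + 1)]→ₗ[ℝ] ℝ) (e : Fin k → V) (x : V) {z : V}
    (hz : z ∈ Submodule.span ℝ (range e)) :
    f (Matrix.vecCons (x + z) e) = f (Matrix.vecCons x e) := by
  have h := congrArg (fun g => g e) (f.curryLeft.map_add x z)
  have h0 := map_vecCons_of_mem_span f e hz
  simp only [AlternatingMap.add_apply, AlternatingMap.curryLeft_apply_apply] at h
  rw [h, h0, add_zero]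

/-- Adding multiples of the first vector to the others does not change an alternating form. -/
theorem map_vecCons_congr (f : V [⋀^Fin (k + 1)]→ₗ[ℝ] ℝ) (x : V) {e e' : Fin k → V}
    (h : ∀ j, e' j - e j ∈ Submodule.span ℝ {x}) :
    f (Matrix.vecCons x e') = f (Matrix.vecCons x e) := by
  have h1 := (f.curryLeft x).toMultilinearMap.map_add_univ e (e' - e)
  rw [add_sub_cancel, Finset.sum_eq_single Finset.univ] at h1
  · rw [Finset.piecewise_univ] at h1
    exact h1
  · intro s _ hs
    obtain ⟨j, hj⟩ : ∃ j, j ∉ s := by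
      by_contra! hall
      exact hs (Finset.eq_univ_iff_forall.2 hall)
    refine f.map_linearDependent _ fun hli => ?_
    change LinearIndependent ℝ (Fin.cons x _ : Fin (k + 1) → V) at hli
    rw [linearIndependent_finCons] at hli
    have h0 := hli.1.ne_zero j
    have hmem := Submodule.subset_span (R := ℝ)
      (mem_range_self (f := s.piecewise e (e' - e)) j)
    rw [Finset.piecewise_eq_of_notMem _ _ _ hj] at h0 hmem
    obtain ⟨c, hc⟩ := Submodule.mem_span_singleton.1 (h j)
    rw [Pi.sub_apply, ← hc] at h0 hmem
    exact hli.2 ((Submodule.smul_mem_iff _ (left_ne_zero_of_smul h0)).1 hmem)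
  · simp

end Alternating

/-- The determinant of `n` vectors in `ℝⁿ`, as an alternating form. -/
noncomputable def detForm (n : ℕ) : E n [⋀^Fin n]→ₗ[ℝ] ℝ :=
  (EuclideanSpace.basisFun (Fin n) ℝ).toBasis.det

theorem det_vecCons_neg {k : ℕ} (u : E (k + 1)) (b : Fin k → E (k + 1)) :
    det (Matrix.vecCons (-u) b) = -det (Matrix.vecCons u b) :=
  congrArg (fun g => g b) ((detForm (k + 1)).curryLeft.map_neg u)

theorem det_vecCons_smul {k : ℕ} (c : ℝ) (u : E (k + 1)) (b : Fin k → E (k + 1)) :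
    det (Matrix.vecCons (c • u) b) = c * det (Matrix.vecCons u b) :=
  congrArg (fun g => g b) ((detForm (k + 1)).curryLeft.map_smul c u)

theorem det_vecCons_vecCons_smul {k : ℕ} (c : ℝ) (u v : E (k + 2)) (b : Fin k → E (k + 2)) :
    det (Matrix.vecCons u (Matrix.vecCons (c • v) b)) =
      c * det (Matrix.vecCons u (Matrix.vecCons v b)) :=
  congrArg (fun g => g b) (((detForm (k + 2)).curryLeft u).curryLeft.map_smul c v)

theorem det_vecCons_vecCons_neg {k : ℕ} (u v : E (k + 2)) (b : Fin k → E (k + 2)) :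
    det (Matrix.vecCons u (Matrix.vecCons (-v) b)) =
      -det (Matrix.vecCons u (Matrix.vecCons v b)) :=
  congrArg (fun g => g b) (((detForm (k + 2)).curryLeft u).curryLeft.map_neg v)

theorem det_vecCons_vecCons_add_of_mem_span {k : ℕ} (u v : E (k + 2)) {z : E (k + 2)}
    {b : Fin k → E (k + 2)} (hz : z ∈ Submodule.span ℝ (range b)) :
    det (Matrix.vecCons u (Matrix.vecCons (v + z) b)) =
      det (Matrix.vecCons u (Matrix.vecCons v b)) :=
  map_vecCons_add_of_mem_span ((detForm (k + 2)).curryLeft u) b v hz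

theorem det_vecCons_vecCons_congr {k : ℕ} (u v : E (k + 2)) {b b' : Fin k → E (k + 2)}
    (h : ∀ j, b' j - b j ∈ Submodule.span ℝ {v}) :
    det (Matrix.vecCons u (Matrix.vecCons v b')) = det (Matrix.vecCons u (Matrix.vecCons v b)) :=
  map_vecCons_congr ((detForm (k + 2)).curryLeft u) v h

theorem det_ne_zero_iff {n : ℕ} (u : Fin n → E n) : det u ≠ 0 ↔ LinearIndependent ℝ u := by
  rw [← isUnit_iff_ne_zero, det, ← Basis.is_basis_iff_det]
  refine ⟨fun h => h.1, fun h => ⟨h, ?_⟩⟩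
  exact h.span_eq_top_of_card_eq_finrank' (by simp)

/-! ### Ridges of a polyhedral hypersurface -/

namespace PolyhedralHypersurface

variable {ι : Type*} {m : ℕ} (X : PolyhedralHypersurface ι m)

theorem convex_cell (i : ι) : Convex ℝ (X.cell i) := (X.isPolyhedron_cell i).convex

theorem nonempty_cell (i : ι) : (X.cell i).Nonempty := by
  rw [nonempty_iff_ne_empty]
  intro h
  have := X.finrank_cell i
  rw [h, vectorSpan_empty, finrank_bot] at this
  omega

theorem finrank_orthogonal_normal (i : ι) :
    finrank ℝ (Submodule.span ℝ {X.normal i})ᗮ = m + 1 := by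
  have h := Submodule.finrank_add_finrank_orthogonal (Submodule.span ℝ {X.normal i})
  rw [finrank_span_singleton (X.normal_ne_zero i), finrank_euclideanSpace_fin] at h
  omega

theorem vectorSpan_cell (i : ι) :
    vectorSpan ℝ (X.cell i) = (Submodule.span ℝ {X.normal i})ᗮ := by
  refine Submodule.eq_of_le_of_finrank_eq ?_
    ((X.finrank_cell i).trans (X.finrank_orthogonal_normal i).symm)
  rw [vectorSpan, Submodule.span_le]
  rintro _ ⟨x, hx, y, hy, rfl⟩
  exact Submodule.mem_orthogonal_singleton_iff_inner_right.2 (X.normal_orthogonal i x hx y hy)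

theorem isExtreme_inter (i j : ι) : IsExtreme ℝ (X.cell i) (X.cell i ∩ X.cell j) :=
  (X.isExposed_inter i j).isExtreme

/-- Since the cells meet along common faces, the smallest face through a point is the same in all
cells containing the point. -/
theorem linealitySpace_congr {i j : ι} {p : E (m + 2)} (hi : p ∈ X.cell i) (hj : p ∈ X.cell j) :
    linealitySpace (X.convex_cell i) hi = linealitySpace (X.convex_cell j) hj := by
  have hc := (X.convex_cell i).inter (X.convex_cell j)
  rw [linealitySpace_eq_of_isExtreme (X.isExtreme_inter i j) hc ⟨hi, hj⟩,
    linealitySpace_eq_of_isExtreme (P := X.cell j) (Q := X.cell i ∩ X.cell j)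
      (by rw [inter_comm]; exact X.isExtreme_inter j i) hc ⟨hi, hj⟩]

/-- `p` lies in the relative interior of the ridge `W`: the ridge is the smallest face containing
`p` of every cell through `p`. -/
structure IsRidgePoint (W : Set (E (m + 2))) (p : E (m + 2)) : Prop where
  isRidge : X.IsRidge W
  mem : p ∈ W
  vectorSpan_eq : ∀ (i : ι) (hi : p ∈ X.cell i), vectorSpan ℝ W = linealitySpace (X.convex_cell i) hi
  subset_cell_iff : ∀ i, W ⊆ X.cell i ↔ p ∈ X.cell i

variable {X}

theorem isRidgePoint_of_isExposed {i : ι} {W : Set (E (m + 2))} {p : E (m + 2)} (hpW : p ∈ W)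
    (hW : IsExposed ℝ (X.cell i) W) (hdim : finrank ℝ (vectorSpan ℝ W) = m)
    (h : ∀ x ∈ W, x - p ∈ linealitySpace (X.convex_cell i) (hW.subset hpW)) :
    X.IsRidgePoint W p where
  isRidge := ⟨⟨p, hpW⟩, hdim, i, hW⟩
  mem := hpW
  vectorSpan_eq j hj := by
    rw [X.linealitySpace_congr hj (hW.subset hpW)]
    refine le_antisymm (vectorSpan_le_of_sub_mem hpW h) fun d hd => ?_
    exact feasibleCone_subset_vectorSpan hpW
      (mem_feasibleCone_of_isExtreme hW.isExtreme hpW hd.1 hd.2)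
  subset_cell_iff j := by
    refine ⟨fun hsub => hsub hpW, fun hj x hx => ?_⟩
    obtain ⟨δ, hδ, h2⟩ := (h x hx).2
    refine ((X.isExtreme_inter i j).left_mem_of_mem_openSegment
      (hW.subset hx) h2 ⟨hW.subset hpW, hj⟩ ?_).2
    refine ⟨δ / (1 + δ), 1 / (1 + δ), by positivity, by positivity, by field_simp; ring, ?_⟩
    match_scalars <;> field_simp
    all_goals ring

theorem exists_isRidgePoint_of_finrank {i : ι} {p : E (m + 2)} (hp : p ∈ X.cell i)
    (hdim : finrank ℝ (linealitySpace (X.convex_cell i) hp) = m) :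
    ∃ W, X.IsRidgePoint W p := by
  have hW := (X.isPolyhedron_cell i).isExposed_linealitySpace hp
  have hpW : p ∈ {x ∈ X.cell i | x - p ∈ linealitySpace (X.convex_cell i) hp} := by
    exact ⟨hp, by simp⟩
  refine ⟨_, isRidgePoint_of_isExposed hpW hW ?_ fun x hx => hx.2⟩
  refine Eq.trans (congrArg (fun U : Submodule ℝ (E (m + 2)) => finrank ℝ U) ?_) hdim
  refine (le_antisymm (vectorSpan_le_of_sub_mem hpW fun x hx => hx.2) fun d hd => ?_)
  exact feasibleCone_subset_vectorSpan hpW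
    (mem_feasibleCone_of_isExtreme hW.isExtreme hpW hd.1 hd.2)

theorem IsRidge.exists_isRidgePoint {W : Set (E (m + 2))} (hW : X.IsRidge W) :
    ∃ p, X.IsRidgePoint W p := by
  obtain ⟨hne, hdim, i, hexp⟩ := hW
  have hconv := hexp.convex (X.convex_cell i)
  obtain ⟨_, ⟨p, hp, rfl⟩⟩ := hne.intrinsicInterior hconv
  have hpW : (p : E (m + 2)) ∈ W := interior_subset (s := ((↑) ⁻¹' W : Set (affineSpan ℝ W))) hp
  refine ⟨p, isRidgePoint_of_isExposed hpW hexp hdim fun x hx => ?_⟩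
  refine ⟨sub_mem_feasibleCone (hexp.subset hx), ?_⟩
  -- moving from `p` away from `x` one stays in the affine span of `W`, hence at first in `W`
  let g : ℝ → affineSpan ℝ W := fun t =>
    ⟨AffineMap.lineMap (p : E (m + 2)) x (-t),
      AffineMap.lineMap_mem _ p.2 (subset_affineSpan ℝ W hx)⟩
  have hg : Continuous g := by
    refine Continuous.subtype_mk ?_ _
    simp only [AffineMap.lineMap_apply_module]
    fun_prop
  have hg0 : g 0 = p := by
    apply Subtype.ext
    simp [g]
  have hev : ∀ᶠ t in 𝓝 (0 : ℝ), g t ∈ ((↑) ⁻¹' W : Set (affineSpan ℝ W)) := by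
    refine hg.continuousAt.eventually_mem ?_
    rw [hg0]
    exact mem_interior_iff_mem_nhds.1 hp
  obtain ⟨t, ht, ht0⟩ := ((hev.filter_mono nhdsWithin_le_nhds).and
    (self_mem_nhdsWithin (s := Ioi (0 : ℝ)))).exists
  refine ⟨t, ht0, hexp.subset ?_⟩
  have hgt : (g t : E (m + 2)) ∈ W := ht
  convert! hgt using 1
  simp only [g, AffineMap.lineMap_apply_module']
  module

/-- At a relative interior point of a ridge, the orientation that a cell induces on the ridge can be
tested with any feasible direction of the cell in place of the inward unit normal. -/
theorem IsRidgePoint.isCompatibleNormal_iff {W : Set (E (m + 2))} {p : E (m + 2)}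
    (h : X.IsRidgePoint W p) {i : ι} (hi : p ∈ X.cell i) {e : Fin m → E (m + 2)}
    (he : Submodule.span ℝ (range e) = vectorSpan ℝ W) (v u : E (m + 2)) :
    IsCompatibleNormal (X.cell i) W e v u ↔ (u = v ∨ u = -v) ∧
      ∃ k ∈ feasibleCone (X.cell i) p, 0 < det (Matrix.vecCons u (Matrix.vecCons k e)) := by
  refine and_congr_right fun _ => ?_
  constructor
  · rintro ⟨w, ⟨-, -, x, hx, t, ht, hmem⟩, hdet⟩
    refine ⟨w, ?_, hdet⟩
    have hz : x - p ∈ linealitySpace (X.convex_cell i) hi := by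
      rw [← h.vectorSpan_eq i hi]
      exact vsub_mem_vectorSpan ℝ hx h.mem
    have h1 := sub_mem_feasibleCone (p := p) hmem
    rw [add_sub_right_comm, add_comm (x - p), add_mem_feasibleCone_iff (X.convex_cell i) hi hz] at h1
    have h2 := smul_mem_feasibleCone (inv_pos.2 ht) h1
    rwa [smul_smul, inv_mul_cancel₀ ht.ne', one_smul] at h2
  · rintro ⟨k, hk, hdet⟩
    -- the inward unit normal is the normalized component of `k` orthogonal to the ridge
    set z := (vectorSpan ℝ W).starProjection k with hz
    have hzmem : -z ∈ vectorSpan ℝ W := neg_mem (Submodule.starProjection_apply_mem _ _)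
    have hdet' : det (Matrix.vecCons u (Matrix.vecCons (k - z) e)) =
        det (Matrix.vecCons u (Matrix.vecCons k e)) := by
      rw [sub_eq_add_neg]
      exact det_vecCons_vecCons_add_of_mem_span u k (he ▸ hzmem)
    have hne : k - z ≠ 0 := by
      intro h0
      have h1 := det_vecCons_vecCons_smul 0 u 0 e
      rw [h0] at hdet'
      simp only [smul_zero, zero_mul] at h1
      rw [← hdet', h1] at hdet
      exact lt_irrefl _ hdet
    have hpos : 0 < ‖k - z‖⁻¹ := inv_pos.2 (norm_pos_iff.2 hne)
    refine ⟨‖k - z‖⁻¹ • (k - z), ⟨?_, ?_, ?_⟩, ?_⟩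
    · rw [norm_smul, norm_inv, norm_norm, inv_mul_cancel₀ (norm_ne_zero_iff.2 hne)]
    · intro x hx y hy
      rw [real_inner_smul_left]
      have : inner ℝ (k - z) (x - y) = 0 := by
        rw [real_inner_comm]
        exact (Submodule.mem_orthogonal _ _).1
          (Submodule.sub_starProjection_mem_orthogonal k) _ (vsub_mem_vectorSpan ℝ hx hy)
      rw [this, mul_zero]
    · have hk' : k - z ∈ feasibleCone (X.cell i) p := by
        rw [sub_eq_add_neg, add_mem_feasibleCone_iff (X.convex_cell i) hi]
        · exact hk
        · rwa [← h.vectorSpan_eq i hi]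
      obtain ⟨ε, hε, hmem⟩ := smul_mem_feasibleCone hpos hk'
      exact ⟨p, h.mem, ε, hε, hmem⟩
    · rw [det_vecCons_vecCons_smul, hdet']
      positivity

end PolyhedralHypersurface

/-! ### The fundamental theorem of calculus along a line in a closed convex set -/

section Line

variable {V : Type*} [AddCommGroup V] [Module ℝ V]

open Classical in
/-- For an oriented line through `p` in direction `d`, meeting `P` in an interval, this is `1` if `p`
is only the final point of the interval, `-1` if it is only the initial point, and `0`
otherwise. -/
noncomputable def endpointSign (P : Set V) (d p : V) : ℝ :=
  (if p ∈ P ∧ d ∉ feasibleCone P p then 1 else 0) -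
    if p ∈ P ∧ -d ∉ feasibleCone P p then 1 else 0

theorem endpointSign_of_notMem {P : Set V} {d p : V} (hp : p ∉ P) : endpointSign P d p = 0 := by
  simp [endpointSign, hp]

open Classical in
theorem endpointSign_congr {V' : Type*} [AddCommGroup V'] [Module ℝ V'] {P : Set V} {Q : Set V'}
    {d p : V} {d' q : V'} (h : p ∈ P ↔ q ∈ Q) (h1 : d ∈ feasibleCone P p ↔ d' ∈ feasibleCone Q q)
    (h2 : -d ∈ feasibleCone P p ↔ -d' ∈ feasibleCone Q q) :
    endpointSign P d p = endpointSign Q d' q := by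
  rw [endpointSign, endpointSign, if_congr (and_congr h (not_congr h1)) rfl rfl,
    if_congr (and_congr h (not_congr h2)) rfl rfl]

theorem endpointSign_of_mem_linealitySpace {P : Set V} (hP : Convex ℝ P) {d p : V} (hp : p ∈ P)
    (hd : d ∈ linealitySpace hP hp) : endpointSign P d p = 0 := by
  simp [endpointSign, hd.1, hd.2]

theorem endpointSign_lineMap (P : Set V) (q d : V) (t : ℝ) :
    endpointSign {s : ℝ | q + s • d ∈ P} 1 t = endpointSign P d (q + t • d) := by
  have h : ∀ c : ℝ, c ∈ feasibleCone {s : ℝ | q + s • d ∈ P} t ↔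
      c • d ∈ feasibleCone P (q + t • d) := by
    intro c
    simp only [feasibleCone, mem_ofPred_eq, smul_eq_mul, add_smul, mul_smul, add_assoc]
  refine endpointSign_congr Iff.rfl ?_ ?_
  · rw [h, one_smul]
  · rw [h, neg_smul, one_smul]

end Line

open Classical in
theorem integral_deriv_eq_finsum_endpointSign {I : Set ℝ} (hI : IsClosed I) (hIc : Convex ℝ I)
    {g g' : ℝ → ℝ} (hg : ∀ t, HasDerivAt g (g' t) t) (hg' : Continuous g')
    (hsupp : HasCompactSupport g) :
    (Function.support fun t => g t * endpointSign I 1 t).Finite ∧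
      ∫ t in I, g' t = ∑ᶠ t, g t * endpointSign I 1 t := by
  obtain ⟨R, hR⟩ : ∃ R : ℝ, tsupport g ⊆ Ioo (-R) R := by
    obtain ⟨R, hR⟩ := hsupp.isCompact.isBounded.subset_ball 0
    refine ⟨R, ?_⟩
    rwa [Real.ball_eq_Ioo, zero_sub, zero_add] at hR
  have hgR : ∀ t, g t ≠ 0 → t ∈ Ioo (-R) R := fun t ht => hR (subset_tsupport g ht)
  have hint : ∫ t in I, g' t = ∫ t in I ∩ Icc (-R) R, g' t := by
    refine (setIntegral_eq_of_subset_of_forall_sdiff_eq_zero hI.measurableSet inter_subset_left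
      fun t ht => ?_)
    have h1 : t ∉ tsupport g := fun h => ht.2 ⟨ht.1, Ioo_subset_Icc_self (hR h)⟩
    have h2 : g =ᶠ[𝓝 t] fun _ => 0 := notMem_tsupport_iff_eventuallyEq.1 h1
    exact ((hg t).congr_of_eventuallyEq h2.symm).unique (hasDerivAt_const t 0)
  rw [hint]
  rcases (I ∩ Icc (-R) R).eq_empty_or_nonempty with hemp | hne
  · have h0 : ∀ t, g t * endpointSign I 1 t = 0 := by
      intro t
      by_cases ht : g t = 0
      · simp [ht]
      · rw [endpointSign_of_notMem, mul_zero]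
        intro hmem
        exact hemp.subset ⟨hmem, Ioo_subset_Icc_self (hgR t ht)⟩
    simp [h0, hemp]
  · obtain ⟨a, b, hIcc⟩ : ∃ a b, I ∩ Icc (-R) R = Icc a b :=
      ⟨_, _, eq_Icc_of_connected_compact
        ⟨hne, (hIc.inter (convex_Icc _ _)).isPreconnected⟩ (isCompact_Icc.inter_left hI)⟩
    have hab : a ≤ b := by rwa [hIcc, nonempty_Icc] at hne
    have ha : a ∈ I ∩ Icc (-R) R := hIcc ▸ left_mem_Icc.2 hab
    have hb : b ∈ I ∩ Icc (-R) R := hIcc ▸ right_mem_Icc.2 hab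
    have hmem : ∀ t ∈ I, g t ≠ 0 → t ∈ Icc a b := fun t ht h0 =>
      hIcc ▸ ⟨ht, Ioo_subset_Icc_self (hgR t h0)⟩
    have hB : ∀ t, g t * (if t ∈ I ∧ (1 : ℝ) ∉ feasibleCone I t then 1 else 0) =
        if t = b then g b else 0 := by
      intro t
      by_cases h0 : g t = 0
      · rw [h0, zero_mul]
        split_ifs with h
        exacts [h ▸ h0.symm, rfl]
      rcases eq_or_ne t b with rfl | hne
      · rw [if_pos, if_pos rfl, mul_one]
        refine ⟨hb.1, fun ⟨ε, hε, h⟩ => ?_⟩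
        have hlt := (hgR t h0).2
        have hmin : 0 < min ε (R - t) := lt_min hε (sub_pos.2 hlt)
        have h1 : t + min ε (R - t) ∈ I := by
          refine hIc.ordConnected.out hb.1 h ⟨by linarith, ?_⟩
          rw [smul_eq_mul, mul_one]
          linarith [min_le_left ε (R - t)]
        have h2 : t + min ε (R - t) ∈ Icc a t := by
          rw [← hIcc]
          exact ⟨h1, by linarith [(hgR t h0).1], by linarith [min_le_right ε (R - t)]⟩
        linarith [h2.2]
      · rw [if_neg hne, if_neg, mul_zero]
        rintro ⟨ht, h1⟩
        have := hmem t ht h0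
        refine h1 ⟨b - t, sub_pos.2 (lt_of_le_of_ne this.2 hne), ?_⟩
        simpa using hb.1
    have hA : ∀ t, g t * (if t ∈ I ∧ (-1 : ℝ) ∉ feasibleCone I t then 1 else 0) =
        if t = a then g a else 0 := by
      intro t
      by_cases h0 : g t = 0
      · rw [h0, zero_mul]
        split_ifs with h
        exacts [h ▸ h0.symm, rfl]
      rcases eq_or_ne t a with rfl | hne
      · rw [if_pos, if_pos rfl, mul_one]
        refine ⟨ha.1, fun ⟨ε, hε, h⟩ => ?_⟩
        have hlt := (hgR t h0).1
        have hmin : 0 < min ε (t + R) := lt_min hε (by linarith)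
        have h1 : t - min ε (t + R) ∈ I := by
          refine hIc.ordConnected.out h ha.1 ⟨?_, by linarith⟩
          rw [smul_eq_mul, mul_neg_one]
          linarith [min_le_left ε (t + R)]
        have h2 : t - min ε (t + R) ∈ Icc t b := by
          rw [← hIcc]
          exact ⟨h1, by linarith [min_le_right ε (t + R)], by linarith [(hgR t h0).2]⟩
        linarith [h2.1]
      · rw [if_neg hne, if_neg, mul_zero]
        rintro ⟨ht, h1⟩
        have := hmem t ht h0
        refine h1 ⟨t - a, sub_pos.2 (lt_of_le_of_ne this.1 hne.symm), ?_⟩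
        simpa using ha.1
    have hsum : (fun t => g t * endpointSign I 1 t) =
        fun t => (if t = b then g b else 0) - if t = a then g a else 0 := by
      funext t
      rw [endpointSign, mul_sub, hA, hB]
    have hfin : ∀ c : ℝ, (Function.support fun t : ℝ => if t = c then g c else 0).Finite :=
      fun c => (finite_singleton c).subset fun t ht => by
        by_contra h
        simp only [mem_singleton_iff] at h
        simp [h] at ht
    rw [hsum, finsum_sub_distrib (hfin b) (hfin a), hIcc, integral_Icc_eq_integral_Ioc,
      ← intervalIntegral.integral_of_le hab, intervalIntegral.integral_eq_sub_of_hasDerivAt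
        (fun t _ => hg t) (hg'.intervalIntegrable a b),
      finsum_eq_single _ b fun t ht => if_neg ht, finsum_eq_single _ a fun t ht => if_neg ht]
    refine ⟨((hfin b).union (hfin a)).subset (Function.support_sub _ _), by simp⟩

/-! ### Integration over a hyperplane in linear coordinates -/

section Hyperplane

variable {m : ℕ}

/-- The integral of an `(m + 1)`-form over a piece `P` of a hyperplane, oriented by its normal vector
`v`, can be computed in any positively oriented affine coordinates `(t, y) ↦ q + t τ + S y` of the
hyperplane. -/
theorem setIntegral_hyperplane {v : E (m + 2)} {b : Fin (m + 1) → E (m + 2)}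
    (hb : IsOrientedFrame v b) {P : Set (E (m + 2))} {q τ : E (m + 2)}
    {S : (Fin m → ℝ) →ₗ[ℝ] E (m + 2)} (hv : v ≠ 0)
    (hP : ∀ x ∈ P, inner ℝ v (x - q) = 0) (hτ : inner ℝ v τ = 0) (hS : ∀ y, inner ℝ v (S y) = 0)
    (hdet : 0 < det (Matrix.vecCons v (Matrix.vecCons τ fun j => S (Pi.single j 1))))
    (η : E (m + 2) → E (m + 2) [⋀^Fin (m + 1)]→L[ℝ] ℝ) :
    ∫ x in P, η x b ∂(Measure.euclideanHausdorffMeasure (m + 1)) =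
      ∫ z in {z : ℝ × (Fin m → ℝ) | q + (z.1 • τ + S z.2) ∈ P},
        η (q + (z.1 • τ + S z.2)) (Matrix.vecCons τ fun j => S (Pi.single j 1)) := by
  set ℓ : Fin (m + 1) → E (m + 2) := Matrix.vecCons τ fun j => S (Pi.single j 1) with hℓ
  -- an isometry `Φ` of `ℝ^{m+1}` onto the hyperplane, given by the frame `b`
  let B := EuclideanSpace.basisFun (Fin (m + 1)) ℝ
  let Φ₀ : E (m + 1) →ₗ[ℝ] E (m + 2) := B.toBasis.constr ℝ b
  have hΦ₀ : ⇑Φ₀ ∘ B.toBasis = b := funext fun j => B.toBasis.constr_basis ℝ b j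
  let Φ : E (m + 1) →ₗᵢ[ℝ] E (m + 2) := Φ₀.isometryOfOrthonormal (v := B.toBasis)
    (by simp) (hΦ₀ ▸ hb.orthonormal)
  have hΦB : ∀ j, Φ (B.toBasis j) = b j := fun j => congrFun hΦ₀ j
  have hrange : LinearMap.range Φ.toLinearMap = (Submodule.span ℝ {v})ᗮ := by
    refine Submodule.eq_of_le_of_finrank_eq ?_ ?_
    · rintro _ ⟨w, rfl⟩
      rw [Submodule.mem_orthogonal_singleton_iff_inner_right]
      have : (innerₛₗ ℝ v).comp Φ.toLinearMap = 0 :=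
        B.toBasis.ext fun j => by
          simpa [hΦB] using! (congrArg (fun x => inner ℝ v x) (hΦB j)).trans (hb.orthogonal j)
      exact congrArg (fun f => f w) this
    · rw [LinearMap.finrank_range_of_inj Φ.injective]
      have h := Submodule.finrank_add_finrank_orthogonal (Submodule.span ℝ {v})
      rw [finrank_span_singleton hv, finrank_euclideanSpace_fin] at h
      rw [finrank_euclideanSpace_fin]
      omega
  have hmem : ∀ w, inner ℝ v w = 0 → ∃ c, Φ c = w := fun w hw =>
    hrange.ge (Submodule.mem_orthogonal_singleton_iff_inner_right.2 hw)
  have hℓv : ∀ j, inner ℝ v (ℓ j) = 0 := by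
    intro j
    cases j using Fin.cases with
    | zero => exact hτ
    | succ j => exact hS _
  choose c hc using fun j => hmem (ℓ j) (hℓv j)
  let A : E (m + 1) →ₗ[ℝ] E (m + 1) := B.toBasis.constr ℝ c
  have hAB : ∀ j, A (B.toBasis j) = c j := B.toBasis.constr_basis ℝ c
  have hΦA : (fun j => Φ (A (B.toBasis j))) = ℓ := funext fun j => by rw [hAB, hc]
  -- both sides of the claim are governed by the determinant of `A`
  have hform : ∀ f : E (m + 2) [⋀^Fin (m + 1)]→ₗ[ℝ] ℝ, f ℓ = LinearMap.det A * f b := by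
    intro f
    have h := (f.compLinearMap Φ.toLinearMap).eq_smul_basis_det B.toBasis
    have h1 := congrArg (fun g => g (fun j => A (B.toBasis j))) h
    have h2 := B.toBasis.det_comp A B.toBasis
    rw [B.toBasis.det_self, mul_one] at h2
    have h3 : (f.compLinearMap Φ.toLinearMap) (fun j => A (B.toBasis j)) = f ℓ :=
      congrArg f hΦA
    have h4 : (f.compLinearMap Φ.toLinearMap) B.toBasis = f b := congrArg f (funext hΦB)
    simp only [AlternatingMap.smul_apply, smul_eq_mul] at h1
    rw [h3, h4] at h1
    rw [h1, mul_comm, ← h2]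
    rfl
  have hA : 0 < LinearMap.det A := by
    have h := hform ((detForm (m + 2)).curryLeft v)
    have h' : det (Matrix.vecCons v ℓ) = LinearMap.det A * det (Matrix.vecCons v b) := h
    rw [h'] at hdet
    exact (pos_iff_pos_of_mul_pos hdet).2 hb.pos
  -- the coordinates are `Φ`, `A` and the identification of `ℝ × ℝ^m` with `ℝ^{m+1}`, combined
  let K : ℝ × (Fin m → ℝ) ≃ᵐ E (m + 1) :=
    (MeasurableEquiv.piFinSuccAbove (fun _ => ℝ) 0).symm.trans (MeasurableEquiv.toLp 2 _)
  have hK : MeasurePreserving K :=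
    ((volume_preserving_piFinSuccAbove (fun _ : Fin (m + 1) => ℝ) 0).symm).trans
      (PiLp.volume_preserving_toLp (Fin (m + 1)))
  let A' : E (m + 1) ≃L[ℝ] E (m + 1) :=
    (LinearEquiv.ofIsUnitDet (f := A) (v := B.toBasis) (v' := B.toBasis)
      (by rw [LinearMap.det_toMatrix]; exact hA.ne'.isUnit)).toContinuousLinearEquiv
  have hA' : ∀ w, A' w = A w := fun w => rfl
  have hTK : ∀ z : ℝ × (Fin m → ℝ), q + (z.1 • τ + S z.2) = q + Φ (A (K z)) := by
    intro z
    congr 1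
    have h1 : K z = ∑ j, (Fin.cons z.1 z.2 : Fin (m + 1) → ℝ) j • B.toBasis j := by
      have := (B.toBasis.sum_repr (K z)).symm
      rw [this]
      refine Finset.sum_congr rfl fun j _ => ?_
      congr 1
      simp [B, K, MeasurableEquiv.piFinSuccAbove, Fin.insertNthEquiv]
    rw [h1, map_sum, map_sum, Fin.sum_univ_succ]
    simp only [map_smul, Fin.cons_zero, Fin.cons_succ]
    have h2 : ∀ j, Φ (A (B.toBasis j)) = ℓ j := fun j => congrFun hΦA j
    simp only [h2, hℓ, Matrix.cons_val_zero, Matrix.cons_val_succ, ← map_smul, ← map_sum]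
    congr 2
    conv_lhs => rw [← Finset.univ_sum_single z.2]
    refine Finset.sum_congr rfl fun j _ => ?_
    rw [← Pi.single_smul, smul_eq_mul, mul_one]
  have hiso : Isometry fun w : E (m + 1) => q + Φ w := (isometry_add_left q).comp Φ.isometry
  have hemb : MeasurableEmbedding fun z : ℝ × (Fin m → ℝ) => q + (z.1 • τ + S z.2) := by
    simp only [hTK]
    exact hiso.isClosedEmbedding.measurableEmbedding.comp
      (A'.toHomeomorph.measurableEmbedding.comp K.measurableEmbedding)
  have hmap : Measure.map (fun z : ℝ × (Fin m → ℝ) => q + (z.1 • τ + S z.2)) volume =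
      ENNReal.ofReal |(LinearMap.det A)⁻¹| •
        (Measure.euclideanHausdorffMeasure (m + 1)).restrict (range fun w : E (m + 1) => q + Φ w) := by
    simp only [hTK]
    rw [← hiso.map_euclideanHausdorffMeasure, EuclideanSpace.euclideanHausdorffMeasure_eq_volume,
      ← Measure.map_smul, ← Measure.map_linearMap_addHaar_eq_smul_addHaar volume hA.ne',
      ← hK.map_eq, Measure.map_map A.continuous_of_finiteDimensional.measurable K.measurable,
      Measure.map_map hiso.continuous.measurable
        (A.continuous_of_finiteDimensional.measurable.comp K.measurable)]
    rfl
  have hPr : P ⊆ range fun w : E (m + 1) => q + Φ w := by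
    intro x hx
    obtain ⟨w, hw⟩ := hmem (x - q) (hP x hx)
    exact ⟨w, by simp [hw]⟩
  have hcv := hemb.setIntegral_map (μ := volume) (fun x => η x ℓ) P
  rw [hmap, Measure.restrict_smul, integral_smul_measure,
    Measure.restrict_restrict_of_subset hPr] at hcv
  refine Eq.trans ?_ hcv
  have : ∀ x, η x ℓ = LinearMap.det A * η x b := fun x => hform (η x).toAlternatingMap
  simp only [this, integral_const_mul]
  rw [ENNReal.toReal_ofReal (abs_nonneg _), abs_of_pos (inv_pos.2 hA), smul_eq_mul,
    inv_mul_cancel_left₀ hA.ne']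

end Hyperplane

/-! ### Slicing a cell by the fibres of a projection -/

section Slice

variable {m n : ℕ}

/-- The constant `k`-form `π^*(dy_1 ∧ … ∧ dy_k)` for a linear map `π` to `ℝ^k`. -/
noncomputable def pullbackVolume {k : ℕ} (π : E n →ₗ[ℝ] (Fin k → ℝ)) : E n [⋀^Fin k]→L[ℝ] ℝ where
  toMultilinearMap := (Matrix.detRowAlternating.compLinearMap π).toMultilinearMap
  cont := by
    change Continuous fun u : Fin k → E n => Matrix.det (fun i => π (u i))
    refine Continuous.matrix_det ?_
    have := π.continuous_of_finiteDimensional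
    fun_prop
  map_eq_zero_of_eq' := (Matrix.detRowAlternating.compLinearMap π).map_eq_zero_of_eq'

theorem pullbackVolume_apply {k : ℕ} (π : E n →ₗ[ℝ] (Fin k → ℝ)) (u : Fin k → E n) :
    pullbackVolume π u = Matrix.det (Matrix.of fun i => π (u i)) := rfl

/-- The value `(l ∧ ω)(u)` of the product of a covector with an alternating form. -/
theorem alternatizeUncurryFin_smulRight_apply {k : ℕ} (l : E n →L[ℝ] ℝ) (ω : E n [⋀^Fin k]→L[ℝ] ℝ)
    (u : Fin (k + 1) → E n) :
    ContinuousAlternatingMap.alternatizeUncurryFin (l.smulRight ω) u =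
      ∑ i : Fin (k + 1), (-1 : ℝ) ^ (i : ℕ) * (l (u i) * ω (i.removeNth u)) := by
  simp [ContinuousAlternatingMap.alternatizeUncurryFin_apply, zsmul_eq_mul]

/-- If the first vector lies in the kernel of `π`, only one term of `l ∧ π^*vol` survives. -/
theorem alternatizeUncurryFin_smulRight_pullbackVolume (l : E n →L[ℝ] ℝ)
    {π : E n →ₗ[ℝ] (Fin m → ℝ)} {τ : E n} (hτ : π τ = 0) {e : Fin m → E n}
    (he : ∀ j, π (e j) = Pi.single j 1) :
    ContinuousAlternatingMap.alternatizeUncurryFin (l.smulRight (pullbackVolume π))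
      (Matrix.vecCons τ e) = l τ := by
  rw [alternatizeUncurryFin_smulRight_apply, Fin.sum_univ_succ, Finset.sum_eq_zero, add_zero]
  · have h1 : Matrix.of (fun i => π ((0 : Fin (m + 1)).removeNth (Matrix.vecCons τ e) i)) =
        (1 : Matrix (Fin m) (Fin m) ℝ) := by
      ext i j
      have : (0 : Fin (m + 1)).removeNth (Matrix.vecCons τ e) i = e i := rfl
      rw [Matrix.of_apply, this, he]
      simp [Matrix.one_apply, Pi.single_apply, eq_comm]
    rw [pullbackVolume_apply, h1, Matrix.det_one]
    simp
  · intro j _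
    obtain ⟨k, rfl⟩ : ∃ k, m = k + 1 := ⟨m - 1, by have := j.2; omega⟩
    have : pullbackVolume π (j.succ.removeNth (Matrix.vecCons τ e)) = 0 := by
      rw [pullbackVolume_apply]
      refine Matrix.det_eq_zero_of_row_eq_zero 0 fun i => ?_
      have : j.succ.removeNth (Matrix.vecCons τ e) 0 = τ := by
        simp [Fin.removeNth]
      rw [Matrix.of_apply, this, hτ]
      rfl
    rw [this, mul_zero, mul_zero]

/-- Coordinates of the hyperplane `v^⊥` adapted to a projection `π` that maps it onto `ℝ^m`: a vector
`τ` spanning its intersection with the kernel of `π`, and a linear section `S` of `π` in it. -/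
structure IsSlicing (v : E (m + 2)) (π : E (m + 2) →ₗ[ℝ] (Fin m → ℝ)) (τ : E (m + 2))
    (S : (Fin m → ℝ) →ₗ[ℝ] E (m + 2)) : Prop where
  inner_fst : inner ℝ v τ = 0
  map_fst : π τ = 0
  inner_section : ∀ y, inner ℝ v (S y) = 0
  map_section : ∀ y, π (S y) = y
  mem_span : ∀ w, inner ℝ v w = 0 → π w = 0 → w ∈ Submodule.span ℝ {τ}
  det_pos : 0 < det (Matrix.vecCons v (Matrix.vecCons τ fun j => S (Pi.single j 1)))

theorem IsSlicing.ne_zero {v : E (m + 2)} {π : E (m + 2) →ₗ[ℝ] (Fin m → ℝ)} {τ : E (m + 2)}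
    {S : (Fin m → ℝ) →ₗ[ℝ] E (m + 2)} (hS : IsSlicing v π τ S) : τ ≠ 0 := by
  rintro rfl
  have h := hS.det_pos
  have h1 := det_vecCons_vecCons_smul 0 v 0 fun j => S (Pi.single j 1)
  simp only [smul_zero, zero_mul] at h1
  exact h.ne' h1

theorem exists_isSlicing {v : E (m + 2)} (hv : v ≠ 0) {π : E (m + 2) →ₗ[ℝ] (Fin m → ℝ)}
    (hπ : Submodule.map π (Submodule.span ℝ {v})ᗮ = ⊤) : ∃ τ S, IsSlicing v π τ S := by
  set H := (Submodule.span ℝ {v})ᗮ with hH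
  have hHmem : ∀ w, w ∈ H ↔ inner ℝ v w = 0 := fun w =>
    Submodule.mem_orthogonal_singleton_iff_inner_right
  let ρ : H →ₗ[ℝ] (Fin m → ℝ) := π.domRestrict H
  have hρ : LinearMap.range ρ = ⊤ := by
    rw [← hπ, LinearMap.range_domRestrict]
  obtain ⟨S₀, hS₀⟩ := ρ.exists_rightInverse_of_surjective hρ
  have hker : finrank ℝ (LinearMap.ker ρ) = 1 := by
    have h1 := ρ.finrank_range_add_finrank_ker
    have h2 := Submodule.finrank_add_finrank_orthogonal (Submodule.span ℝ {v})
    rw [finrank_span_singleton hv, finrank_euclideanSpace_fin, ← hH] at h2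
    rw [hρ, finrank_top, Module.finrank_fin_fun] at h1
    omega
  obtain ⟨⟨⟨τ, hτH⟩, hτk⟩, hτ0, hτs⟩ := finrank_eq_one_iff'.1 hker
  have hτ1 : τ ≠ 0 := fun h => hτ0 (by simp [h])
  let S := H.subtype.comp S₀
  have hS1 : ∀ y, inner ℝ v (S y) = 0 := fun y => (hHmem _).1 (S₀ y).2
  have hS2 : ∀ y, π (S y) = y := fun y => congrArg (fun f => f y) hS₀
  have hπτ : π τ = 0 := hτk
  have hvτ : inner ℝ v τ = 0 := (hHmem _).1 hτH
  have hspan : ∀ w, inner ℝ v w = 0 → π w = 0 → w ∈ Submodule.span ℝ {τ} := by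
    intro w hw hw'
    obtain ⟨c, hc⟩ := hτs ⟨⟨w, (hHmem w).2 hw⟩, hw'⟩
    exact Submodule.mem_span_singleton.2 ⟨c, congrArg (fun x : LinearMap.ker ρ => ((x : H) : E (m + 2))) hc⟩
  have hdet : det (Matrix.vecCons v (Matrix.vecCons τ fun j => S (Pi.single j 1))) ≠ 0 := by
    rw [det_ne_zero_iff, Matrix.vecCons, linearIndependent_finCons, Matrix.vecCons,
      linearIndependent_finCons]
    refine ⟨⟨?_, fun hmem => hτ1 ?_⟩, fun hmem => hv ?_⟩
    · refine LinearIndependent.of_comp π ?_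
      have : π ∘ (fun j => S (Pi.single j 1)) = Pi.basisFun ℝ (Fin m) := by
        funext j
        simp [hS2]
      rw [this]
      exact (Pi.basisFun ℝ (Fin m)).linearIndependent
    · have : τ ∈ LinearMap.range S := by
        refine Submodule.span_le.2 ?_ hmem
        rintro _ ⟨j, rfl⟩
        exact ⟨_, rfl⟩
      obtain ⟨y, rfl⟩ := this
      rw [hS2] at hπτ
      rw [hπτ, map_zero]
    · have : v ∈ H := by
        refine Submodule.span_le.2 ?_ hmem
        rintro _ ⟨j, rfl⟩
        cases j using Fin.cases with
        | zero => exact hτH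
        | succ j => exact (hHmem _).2 (hS1 _)
      exact inner_self_eq_zero.1 ((hHmem v).1 this)
  rcases hdet.lt_or_gt with hneg | hpos
  · refine ⟨-τ, S, by simp [hvτ], by simp [hπτ], hS1, hS2, fun w h1 h2 => ?_, ?_⟩
    · rw [← Set.neg_singleton, Submodule.span_neg]
      exact hspan w h1 h2
    · rw [det_vecCons_vecCons_neg]
      exact neg_pos.2 hneg
  · exact ⟨τ, S, hvτ, hπτ, hS1, hS2, hspan, hpos⟩

/-- If `π` does not map `v^⊥` onto `ℝ^m`, then `π^*vol` vanishes on `v^⊥`. -/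
theorem pullbackVolume_eq_zero {k : ℕ} {H : Submodule ℝ (E n)} {π : E n →ₗ[ℝ] (Fin k → ℝ)}
    (hπ : Submodule.map π H ≠ ⊤) {u : Fin k → E n} (hu : ∀ j, u j ∈ H) :
    pullbackVolume π u = 0 := by
  by_contra h
  refine hπ (eq_top_iff.2 ?_)
  have hli : LinearIndependent ℝ (fun i => π (u i)) := by
    rw [pullbackVolume_apply] at h
    exact Matrix.linearIndependent_rows_of_det_ne_zero h
  rw [← hli.span_eq_top_of_card_eq_finrank' (by simp), Submodule.span_le]
  rintro _ ⟨j, rfl⟩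
  exact ⟨_, hu j, rfl⟩

open Classical in
/-- The contribution of the point `p` to the slice over `y` of the boundary of a
cell `P`. -/
noncomputable def fiberTerm (P : Set (E (m + 2))) (π : E (m + 2) →ₗ[ℝ] (Fin m → ℝ)) (τ : E (m + 2))
    (φ : E (m + 2) → ℝ) (y : Fin m → ℝ) (p : E (m + 2)) : ℝ :=
  if π p = y then φ p * endpointSign P τ p else 0

variable {ι : Type*} (X : PolyhedralHypersurface ι m)

/-- **Stokes' theorem for a cell, fibrewise.** In coordinates adapted to `π`, the form
`d(φ π^*vol)` restricts to the derivative of `φ` along the fibres of `π`, which meet the cell in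
intervals. -/
theorem PolyhedralHypersurface.integral_cell_eq_integral_fiber (i : ι) {π : E (m + 2) →ₗ[ℝ] (Fin m → ℝ)} {τ : E (m + 2)}
    {S : (Fin m → ℝ) →ₗ[ℝ] E (m + 2)} (hS : IsSlicing (X.normal i) π τ S)
    (φ : Test (E (m + 2)) ℝ) :
    (∀ y, (Function.support (fiberTerm (X.cell i) π τ φ y)).Finite) ∧
    Integrable (fun y => ∑ᶠ p, fiberTerm (X.cell i) π τ φ y p) ∧
    ∫ x in X.cell i, ContinuousAlternatingMap.alternatizeUncurryFin
        ((fderiv ℝ φ x).smulRight (pullbackVolume π)) (orientedFrame (X.normal i))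
        ∂(Measure.euclideanHausdorffMeasure (m + 1)) =
      ∫ y, ∑ᶠ p, fiberTerm (X.cell i) π τ φ y p := by
  obtain ⟨p₀, hp₀⟩ := X.nonempty_cell i
  have hv := X.normal_ne_zero i
  have hτ0 : τ ≠ 0 := hS.ne_zero
  -- the base point is chosen in the fibre over `0`
  set q := p₀ - S (π p₀) with hq
  have hπq : π q = 0 := by rw [hq, map_sub, hS.map_section, sub_self]
  have hqv : ∀ x ∈ X.cell i, inner ℝ (X.normal i) (x - q) = 0 := by
    intro x hx
    rw [hq, sub_sub_eq_add_sub, add_sub_right_comm, inner_add_right, hS.inner_section, add_zero]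
    exact X.normal_orthogonal i x hx p₀ hp₀
  set T : ℝ × (Fin m → ℝ) → E (m + 2) := fun z => q + (z.1 • τ + S z.2) with hT
  have hTemb : Topology.IsClosedEmbedding T := by
    let T₀ : ℝ × (Fin m → ℝ) →ₗ[ℝ] E (m + 2) := (LinearMap.toSpanSingleton ℝ _ τ).coprod S
    have hinj : LinearMap.ker T₀ = ⊥ := by
      rw [LinearMap.ker_eq_bot']
      rintro ⟨t, y⟩ h
      have h0 : t • τ + S y = 0 := h
      have hy : y = 0 := by
        have := congrArg π h0
        rwa [map_add, map_smul, hS.map_fst, hS.map_section, smul_zero, zero_add, map_zero] at this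
      rw [hy, map_zero, add_zero, smul_eq_zero] at h0
      rw [hy, h0.resolve_right hτ0]
      rfl
    exact (Homeomorph.addLeft q).isClosedEmbedding.comp
      (LinearMap.isClosedEmbedding_of_injective hinj)
  have hφd : Differentiable ℝ φ := φ.contDiff.differentiable (by simp)
  have hφ' : Continuous (fderiv ℝ φ) := φ.contDiff.continuous_fderiv (by simp)
  have hφs : HasCompactSupport (fderiv ℝ φ) := φ.hasCompactSupport.fderiv (𝕜 := ℝ)
  -- reduce to an integral over `ℝ × ℝ^m`
  have hcv := setIntegral_hyperplane (isOrientedFrame_orientedFrame _ hv) hv hqv hS.inner_fst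
    hS.inner_section hS.det_pos fun x => ContinuousAlternatingMap.alternatizeUncurryFin
        ((fderiv ℝ φ x).smulRight (pullbackVolume π))
  simp only [alternatizeUncurryFin_smulRight_pullbackVolume _ hS.map_fst
    fun j => hS.map_section (Pi.single j 1)] at hcv
  have hclosed : IsClosed (X.cell i) := (X.isPolyhedron_cell i).isClosed
  have hTcl : IsClosed (T ⁻¹' X.cell i) := hclosed.preimage hTemb.continuous
  have hint : Integrable ((T ⁻¹' X.cell i).indicator fun z => fderiv ℝ φ (T z) τ)
      (volume.prod volume) := by
    refine Integrable.indicator ?_ hTcl.measurableSet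
    refine Continuous.integrable_of_hasCompactSupport ?_ ?_
    · exact (hφ'.comp hTemb.continuous).clm_apply continuous_const
    · exact (hφs.comp_isClosedEmbedding hTemb).comp_left
        (g := fun l : E (m + 2) →L[ℝ] ℝ => l τ) rfl
  -- the fibre over `y` is the line `t ↦ q + S y + t τ`
  have hTline : ∀ t y, T (t, y) = (q + S y) + t • τ := fun t y => by
    simp only [hT]
    abel
  have hinj : ∀ y, Function.Injective fun t : ℝ => (q + S y) + t • τ := fun y a b hab =>
    smul_left_injective ℝ hτ0 (add_left_cancel hab)
  have hline : ∀ y, (Function.support fun t : ℝ =>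
        φ ((q + S y) + t • τ) * endpointSign (X.cell i) τ ((q + S y) + t • τ)).Finite ∧
      ∫ t, (T ⁻¹' X.cell i).indicator (fun z => fderiv ℝ φ (T z) τ) (t, y) =
        ∑ᶠ t : ℝ, φ ((q + S y) + t • τ) * endpointSign (X.cell i) τ ((q + S y) + t • τ) := by
    intro y
    have hcont : Continuous fun t : ℝ => (q + S y) + t • τ := by fun_prop
    have hcl : IsClosed {t : ℝ | (q + S y) + t • τ ∈ X.cell i} := hclosed.preimage hcont
    have hconv : Convex ℝ {t : ℝ | (q + S y) + t • τ ∈ X.cell i} := by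
      intro a ha b hb r t hr ht hrt
      have := X.convex_cell i ha hb hr ht hrt
      obtain rfl : r = 1 - t := by linarith
      change _ ∈ X.cell i
      convert this using 1
      simp only [smul_eq_mul]
      module
    have hemb : Topology.IsClosedEmbedding fun t : ℝ => (q + S y) + t • τ :=
      (Homeomorph.addLeft (q + S y)).isClosedEmbedding.comp
        (isClosedEmbedding_smul_left hτ0)
    have hder : ∀ t : ℝ, HasDerivAt (fun t : ℝ => φ ((q + S y) + t • τ))
        (fderiv ℝ φ ((q + S y) + t • τ) τ) t := by
      intro t
      have h1 : HasDerivAt (fun t : ℝ => (q + S y) + t • τ) τ t := by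
        simpa using ((hasDerivAt_id t).smul_const τ).const_add (q + S y)
      exact (hφd _).hasFDerivAt.comp_hasDerivAt t h1
    have := integral_deriv_eq_finsum_endpointSign hcl hconv hder
      ((hφ'.comp hcont).clm_apply continuous_const) (φ.hasCompactSupport.comp_isClosedEmbedding hemb)
    simp only [endpointSign_lineMap] at this
    refine ⟨this.1, Eq.trans ?_ this.2⟩
    rw [← integral_indicator hcl.measurableSet]
    congr 1
    funext t
    simp only [← hTline]
    rfl
  have hπline : ∀ (y : Fin m → ℝ) (t : ℝ), π ((q + S y) + t • τ) = y := fun y t => by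
    rw [map_add, map_add, map_smul, hπq, hS.map_fst, hS.map_section, smul_zero, add_zero, zero_add]
  have hsupp : ∀ y, Function.support (fiberTerm (X.cell i) π τ φ y) ⊆
      range fun t : ℝ => (q + S y) + t • τ := by
    intro y p hp
    have hpy : π p = y := by
      by_contra h
      simp [fiberTerm, h] at hp
    have hpP : p ∈ X.cell i := by
      by_contra h
      simp [fiberTerm, endpointSign_of_notMem h] at hp
    have hmem := hS.mem_span (p - (q + S y))
      (by rw [← sub_sub, inner_sub_right, hqv p hpP, hS.inner_section, sub_zero])
      (by rw [map_sub, map_add, hπq, hS.map_section, hpy, zero_add, sub_self])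
    obtain ⟨t, ht⟩ := Submodule.mem_span_singleton.1 hmem
    exact ⟨t, by simp [ht]⟩
  have hterm : ∀ y t, fiberTerm (X.cell i) π τ φ y ((q + S y) + t • τ) =
      φ ((q + S y) + t • τ) * endpointSign (X.cell i) τ ((q + S y) + t • τ) := fun y t =>
    if_pos (hπline y t)
  have hsum : ∀ y, ∑ᶠ p, fiberTerm (X.cell i) π τ φ y p =
      ∫ t, (T ⁻¹' X.cell i).indicator (fun z => fderiv ℝ φ (T z) τ) (t, y) := by
    intro y
    rw [(hline y).2, ← finsum_mem_univ, ← finsum_mem_inter_support, univ_inter,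
      ← inter_eq_right.2 (hsupp y), finsum_mem_inter_support, finsum_mem_range (hinj y)]
    simp only [hterm]
  refine ⟨fun y => ?_, ?_, ?_⟩
  · refine (((hline y).1).image fun t : ℝ => (q + S y) + t • τ).subset fun p hp => ?_
    obtain ⟨t, rfl⟩ := hsupp y hp
    refine ⟨t, ?_, rfl⟩
    rw [Function.mem_support, ← hterm]
    exact hp
  · simp only [hsum]
    exact hint.integral_prod_right
  · simp only [hsum]
    rw [← integral_prod_symm _ hint, hcv]
    exact (integral_indicator hTcl.measurableSet).symm

/-- A cell that does not project onto `ℝ^m` does not contribute. -/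
theorem PolyhedralHypersurface.integral_cell_eq_zero (i : ι) {π : E (m + 2) →ₗ[ℝ] (Fin m → ℝ)}
    (hπ : Submodule.map π (Submodule.span ℝ {X.normal i})ᗮ ≠ ⊤) (φ : Test (E (m + 2)) ℝ) :
    ∫ x in X.cell i, ContinuousAlternatingMap.alternatizeUncurryFin
        ((fderiv ℝ φ x).smulRight (pullbackVolume π)) (orientedFrame (X.normal i))
        ∂(Measure.euclideanHausdorffMeasure (m + 1)) = 0 := by
  have hb := isOrientedFrame_orientedFrame _ (X.normal_ne_zero i)
  simp only [alternatizeUncurryFin_smulRight_apply]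
  refine integral_eq_zero_of_ae (Filter.Eventually.of_forall fun x => ?_)
  refine Finset.sum_eq_zero fun j _ => ?_
  rw [pullbackVolume_eq_zero hπ, mul_zero, mul_zero]
  exact fun k => Submodule.mem_orthogonal_singleton_iff_inner_right.2 (hb.orthogonal _)

end Slice

/-! ### Super forms as combinations of pulled back volume forms -/

section Forms

variable {m n : ℕ}

/-- The projection of `ℝⁿ` to the coordinates listed by `f`. -/
noncomputable def coordProj {k : ℕ} (f : Fin k → Fin n) : E n →ₗ[ℝ] (Fin k → ℝ) where
  toFun x j := x (f j)
  map_add' _ _ := rfl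
  map_smul' _ _ := rfl

theorem coordProj_apply {k : ℕ} (f : Fin k → Fin n) (x : E n) (j : Fin k) :
    coordProj f x j = x (f j) := rfl

/-- An alternating form is a combination of the forms `dx_{f 1} ∧ … ∧ dx_{f k}`. Summing over all
maps `f`, and not only over increasing ones, every term is counted `k!` times. -/
theorem eq_sum_pullbackVolume {F : Type*} [NormedAddCommGroup F] [NormedSpace ℝ F] {k : ℕ}
    (η : E n [⋀^Fin k]→L[ℝ] F) (u : Fin k → E n) :
    η u = (k.factorial : ℝ)⁻¹ • ∑ f : Fin k → Fin n,
      pullbackVolume (coordProj f) u • η (fun j => EuclideanSpace.basisFun (Fin n) ℝ (f j)) := by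
  set e := EuclideanSpace.basisFun (Fin n) ℝ with he
  have hexp : ∀ w : Fin k → E n, η w =
      ∑ f : Fin k → Fin n, (∏ j, w j (f j)) • η (fun j => e (f j)) := by
    intro w
    have h1 : w = fun j => ∑ i, w j i • e i := by
      funext j
      simpa [he] using (e.sum_repr (w j)).symm
    conv_lhs => rw [h1]
    have h2 := η.toMultilinearMap.map_sum (fun j i => w j i • e i)
    refine h2.trans (Finset.sum_congr rfl fun f _ => ?_)
    exact η.toMultilinearMap.map_smul_univ (fun j => w j (f j)) fun j => e (f j)
  have hperm : ∀ σ : Equiv.Perm (Fin k),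
      ∑ f : Fin k → Fin n, (Equiv.Perm.sign σ : ℝ) • (∏ j, u (σ j) (f j)) • η (fun j => e (f j)) =
        η u := by
    intro σ
    rw [← Finset.smul_sum, ← hexp (fun j => u (σ j))]
    have h3 : η (u ∘ σ) = Equiv.Perm.sign σ • η u := η.toAlternatingMap.map_perm u σ
    have h4 : (fun j => u (σ j)) = u ∘ σ := rfl
    rw [h4, h3, Units.smul_def, ← Int.cast_smul_eq_zsmul ℝ, smul_smul, ← Int.cast_mul,
      ← Units.val_mul, Int.units_mul_self, Units.val_one, Int.cast_one, one_smul]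
  have hdet : ∀ f : Fin k → Fin n, pullbackVolume (coordProj f) u • η (fun j => e (f j)) =
      ∑ σ : Equiv.Perm (Fin k),
        (Equiv.Perm.sign σ : ℝ) • (∏ j, u (σ j) (f j)) • η (fun j => e (f j)) := by
    intro f
    rw [pullbackVolume_apply, Matrix.det_apply', Finset.sum_smul]
    simp only [Matrix.of_apply, coordProj_apply, mul_smul]
  simp only [hdet]
  rw [Finset.sum_comm]
  simp only [hperm]
  rw [Finset.sum_const, Finset.card_univ, Fintype.card_perm, Fintype.card_fin,
    ← Nat.cast_smul_eq_nsmul ℝ, smul_smul, inv_mul_cancel₀, one_smul]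
  exact_mod_cast k.factorial_ne_zero

/-- The covector `ω ⊗ β`, which stands for `ω ∧ β` if `β` is a form in the `ξ`-directions. -/
noncomputable def tensorCovector {p q : ℕ} (ω : E n [⋀^Fin p]→L[ℝ] ℝ) (β : E n [⋀^Fin q]→L[ℝ] ℝ) :
    SuperCovector n p q :=
  (ContinuousLinearMap.toSpanSingleton ℝ β).compContinuousAlternatingMap ω

theorem tensorCovector_apply {p q : ℕ} (ω : E n [⋀^Fin p]→L[ℝ] ℝ) (β : E n [⋀^Fin q]→L[ℝ] ℝ)
    (u : Fin p → E n) : tensorCovector ω β u = ω u • β := rfl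

/-- The form `φ c` with a constant covector `c` and a scalar test function `φ`. -/
noncomputable def scalarForm {p q : ℕ} (c : SuperCovector n p q) (φ : Test (E n) ℝ) :
    TestForm n p q :=
  postcomp (ContinuousLinearMap.toSpanSingleton ℝ c) φ

theorem scalarForm_apply {p q : ℕ} (c : SuperCovector n p q) (φ : Test (E n) ℝ) (x : E n) :
    scalarForm c φ x = φ x • c := rfl

/-- The coefficient of a form at two families of standard basis vectors. -/
noncomputable def coeffFunction {p q : ℕ} (f : Fin p → Fin n) (g : Fin q → Fin n)
    (α : TestForm n p q) : Test (E n) ℝ :=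
  postcomp ((ContinuousAlternatingMap.apply ℝ (E n) ℝ
      (fun j => EuclideanSpace.basisFun (Fin n) ℝ (g j))).comp
    (ContinuousAlternatingMap.apply ℝ (E n) (E n [⋀^Fin q]→L[ℝ] ℝ)
      (fun j => EuclideanSpace.basisFun (Fin n) ℝ (f j)))) α

theorem testForm_eq_sum {p q : ℕ} (α : TestForm n p q) :
    α = ((p.factorial : ℝ)⁻¹ * (q.factorial : ℝ)⁻¹) • ∑ f : Fin p → Fin n, ∑ g : Fin q → Fin n,
      scalarForm (tensorCovector (pullbackVolume (coordProj f)) (pullbackVolume (coordProj g)))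
        (coeffFunction f g α) := by
  ext x u w
  have h1 := congrArg (fun β => β w) (eq_sum_pullbackVolume (α x) u)
  simp only [ContinuousAlternatingMap.smul_apply, ContinuousAlternatingMap.sum_apply] at h1
  rw [h1]
  have h2 := fun f : Fin p → Fin n =>
    eq_sum_pullbackVolume (α x fun j => EuclideanSpace.basisFun (Fin n) ℝ (f j)) w
  simp only [h2]
  simp only [FunLike.coe_smul, FunLike.coe_sum, Pi.smul_apply, Finset.sum_apply,
    ContinuousAlternatingMap.smul_apply, ContinuousAlternatingMap.sum_apply, scalarForm_apply,
    tensorCovector_apply, smul_eq_mul, Finset.mul_sum]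
  refine Finset.sum_congr rfl fun f _ => Finset.sum_congr rfl fun g _ => ?_
  have : coeffFunction f g α x = α x (fun j => EuclideanSpace.basisFun (Fin n) ℝ (f j))
    (fun j => EuclideanSpace.basisFun (Fin n) ℝ (g j)) := rfl
  rw [this]
  ring

/-- The coefficient of `v^* ∧ β` with respect to `dξ_1 ∧ … ∧ dξ_n`, as a linear function
of `v`. -/
noncomputable def wedgePairing (β : E (n + 1) [⋀^Fin n]→L[ℝ] ℝ) : E (n + 1) →ₗ[ℝ] ℝ where
  toFun v := wedgeCovector n (innerSL ℝ v) β (EuclideanSpace.basisFun (Fin (n + 1)) ℝ)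
  map_add' v w := by
    simp only [wedgeCovector_apply, ← Finset.sum_add_distrib, map_add]
    refine Finset.sum_congr rfl fun i _ => ?_
    rw [_root_.add_apply]
    ring
  map_smul' c v := by
    simp only [wedgeCovector_apply, smul_eq_mul, Finset.mul_sum, map_smul, RingHom.id_apply]
    refine Finset.sum_congr rfl fun i _ => ?_
    rw [_root_.smul_apply, smul_eq_mul]
    ring

theorem wedgePairing_apply (β : E (n + 1) [⋀^Fin n]→L[ℝ] ℝ) (v : E (n + 1)) :
    wedgePairing β v =
      wedgeCovector n (innerSL ℝ v) β (EuclideanSpace.basisFun (Fin (n + 1)) ℝ) := rfl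

theorem eq_zero_of_wedgePairing_eq_zero {v : E (n + 1)} (h : ∀ β, wedgePairing β v = 0) :
    v = 0 := by
  ext i
  -- test with the form `dξ_0 ∧ … ∧ dξ_n` in which the factor `dξ_i` is left out
  have h1 := h (pullbackVolume (coordProj i.succAbove))
  rw [wedgePairing_apply, wedgeCovector_apply, Finset.sum_eq_single i] at h1
  · have h2 : pullbackVolume (coordProj i.succAbove)
        (i.removeNth (EuclideanSpace.basisFun (Fin (n + 1)) ℝ)) = 1 := by
      rw [pullbackVolume_apply, ← Matrix.det_one (n := Fin n)]
      congr 1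
      ext j k
      simp [coordProj_apply, Fin.removeNth, Matrix.one_apply, eq_comm]
    rw [h2, mul_one] at h1
    simpa [EuclideanSpace.inner_single_right] using h1
  · intro j _ hj
    obtain ⟨k, rfl⟩ := Fin.exists_succAbove_eq hj.symm
    have h2 : pullbackVolume (coordProj (j.succAbove k).succAbove)
        (j.removeNth (EuclideanSpace.basisFun (Fin (n + 1)) ℝ)) = 0 := by
      rw [pullbackVolume_apply]
      refine Matrix.det_eq_zero_of_row_eq_zero k fun l => ?_
      simp [coordProj_apply, Fin.removeNth]
    rw [h2, mul_zero, mul_zero]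
  · simp

end Forms

theorem fderiv_postcomp {V F G : Type*} [NormedAddCommGroup V] [NormedSpace ℝ V]
    [NormedAddCommGroup F] [NormedSpace ℝ F] [NormedAddCommGroup G] [NormedSpace ℝ G]
    (L : F →L[ℝ] G) (φ : Test V F) (x : V) :
    fderiv ℝ (⇑(postcomp L φ)) x = L.comp (fderiv ℝ φ x) :=
  (L.hasFDerivAt.comp x (φ.contDiff.differentiable (by simp) x).hasFDerivAt).fderiv

theorem dForm_scalarForm_apply {n p q : ℕ} (ω : E n [⋀^Fin p]→L[ℝ] ℝ) (β : E n [⋀^Fin q]→L[ℝ] ℝ)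
    (φ : Test (E n) ℝ) (x : E n) (u : Fin (p + 1) → E n) :
    dForm n p q (scalarForm (tensorCovector ω β) φ) x u =
      ContinuousAlternatingMap.alternatizeUncurryFin ((fderiv ℝ φ x).smulRight ω) u • β := by
  have h1 : fderiv ℝ (⇑(scalarForm (tensorCovector ω β) φ)) x =
      (ContinuousLinearMap.toSpanSingleton ℝ (tensorCovector ω β)).comp (fderiv ℝ φ x) :=
    fderiv_postcomp _ φ x
  rw [dForm, extD_apply, extDeriv, h1, alternatizeUncurryFin_smulRight_apply,
    ContinuousAlternatingMap.alternatizeUncurryFin_apply, Finset.sum_smul]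
  refine Finset.sum_congr rfl fun j _ => ?_
  rw [ContinuousLinearMap.comp_apply, ContinuousLinearMap.toSpanSingleton_apply,
    ContinuousAlternatingMap.smul_apply,
    tensorCovector_apply, smul_smul, ← Int.cast_smul_eq_zsmul ℝ, smul_smul]
  simp

namespace PolyhedralHypersurface

variable {ι : Type*} [Fintype ι] {m : ℕ} (X : PolyhedralHypersurface ι m)

theorem current_dForm_scalarForm (ω : E (m + 2) [⋀^Fin m]→L[ℝ] ℝ)
    (β : E (m + 2) [⋀^Fin (m + 1)]→L[ℝ] ℝ) (φ : Test (E (m + 2)) ℝ) :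
    X.current (dForm _ _ _ (scalarForm (tensorCovector ω β) φ)) =
      (-1 : ℝ) ^ (m + 1) * ∑ i, wedgePairing β (X.normal i) *
        ∫ x in X.cell i, ContinuousAlternatingMap.alternatizeUncurryFin
          ((fderiv ℝ φ x).smulRight ω) (orientedFrame (X.normal i))
          ∂(Measure.euclideanHausdorffMeasure (m + 1)) := by
  rw [current_apply, Finset.mul_sum]
  refine Finset.sum_congr rfl fun i _ => ?_
  rw [← mul_assoc, ← integral_const_mul]
  congr 1
  funext x
  rw [wedgeJ_apply, dForm_scalarForm_apply, map_smul, ContinuousAlternatingMap.smul_apply,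
    ContinuousAlternatingMap.smul_apply, wedgePairing_apply, smul_eq_mul, smul_eq_mul]
  ring

end PolyhedralHypersurface

/-! ### Generic fibres -/

section Generic

variable {m n : ℕ}

/-- The faces of a polyhedron whose image under `π` has empty interior are met by almost no
fibre of `π`. -/
theorem IsPolyhedron.ae_map_linealitySpace {P : Set (E n)} (hP : IsPolyhedron P)
    (π : E n →ₗ[ℝ] (Fin m → ℝ)) :
    ∀ᵐ y : Fin m → ℝ, ∀ (p : E n) (hp : p ∈ P), π p = y →
      Submodule.map π (linealitySpace hP.convex hp) = ⊤ := by
  have hconv := hP.convex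
  obtain ⟨s, hs, rfl⟩ := hP
  -- the direction space of the face on which the constraints in `A` are active
  let U : Set (E n × ℝ) → Submodule ℝ (E n) := fun A =>
    ⨅ a ∈ A, LinearMap.ker (innerₛₗ ℝ a.1)
  have hU : ∀ A d, d ∈ U A ↔ ∀ a ∈ A, inner ℝ a.1 d = 0 := fun A d => by simp [U]
  have key : ∀ A ∈ {A | A ⊆ s}, ∀ᵐ y : Fin m → ℝ, ∀ (p : E n) (hp : ∀ a ∈ s, inner ℝ a.1 p ≤ a.2),
      activeConstraints s p = A → π p = y → Submodule.map π (U A) = ⊤ := by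
    intro A _
    by_cases htop : Submodule.map π (U A) = ⊤
    · exact Filter.Eventually.of_forall fun _ _ _ _ _ => htop
    by_cases hex : ∃ p₀, ∀ a ∈ A, inner ℝ a.1 p₀ = a.2
    swap
    · refine Filter.Eventually.of_forall fun _ p _ hpA _ => absurd ⟨p, fun a ha => ?_⟩ hex
      rw [← hpA] at ha
      exact ha.2
    obtain ⟨p₀, hp₀⟩ := hex
    let Q : AffineSubspace ℝ (Fin m → ℝ) := AffineSubspace.mk' (π p₀) (Submodule.map π (U A))
    have hQ : Q ≠ ⊤ := fun h => htop (by
      rw [← AffineSubspace.direction_mk' (π p₀) (Submodule.map π (U A))]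
      change Q.direction = ⊤
      rw [h, AffineSubspace.direction_top])
    have hnull := Measure.addHaar_affineSubspace volume Q hQ
    filter_upwards [compl_mem_ae_iff.2 hnull] with y hy p hp hpA hpy
    refine absurd ?_ hy
    rw [SetLike.mem_coe, AffineSubspace.mem_mk', ← hpy]
    refine ⟨p - p₀, (hU A _).2 fun a ha => ?_, by simp⟩
    rw [inner_sub_right, hp₀ a ha, sub_eq_zero]
    rw [← hpA] at ha
    exact ha.2
  filter_upwards [(ae_ball_iff hs.finite_subsets.countable).2 key] with y hy p hp hpy
  convert hy (activeConstraints s p) (sep_subset _ _) p hp rfl hpy using 2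
  ext d
  rw [mem_linealitySpace_iff_activeConstraints hs, hU]

end Generic

/-! ### The balancing of a hypersurface at a point -/

theorem eq_zero_of_mem_span_of_map_eq_zero {m n : ℕ} {π : E n →ₗ[ℝ] (Fin m → ℝ)} {e : Fin m → E n}
    (he : ∀ j, π (e j) = Pi.single j 1) {z : E n} (hz : z ∈ Submodule.span ℝ (range e))
    (hπz : π z = 0) : z = 0 := by
  obtain ⟨c, rfl⟩ := (Submodule.mem_span_range_iff_exists_fun ℝ).1 hz
  have hc : c = 0 := by
    rw [← hπz, map_sum]
    simp only [map_smul, he]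
    conv_lhs => rw [← Finset.univ_sum_single c]
    refine Finset.sum_congr rfl fun j _ => ?_
    rw [← Pi.single_smul, smul_eq_mul, mul_one]
  simp [hc]

theorem exists_mem_span_map_eq {m n : ℕ} {π : E n →ₗ[ℝ] (Fin m → ℝ)} {e : Fin m → E n}
    (he : ∀ j, π (e j) = Pi.single j 1) (y : Fin m → ℝ) :
    ∃ z ∈ Submodule.span ℝ (range e), π z = y := by
  refine ⟨∑ j, y j • e j, Submodule.sum_mem _ fun j _ =>
    Submodule.smul_mem _ _ (Submodule.subset_span ⟨j, rfl⟩), ?_⟩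
  rw [map_sum]
  simp only [map_smul, he]
  conv_rhs => rw [← Finset.univ_sum_single y]
  refine Finset.sum_congr rfl fun j _ => ?_
  rw [← Pi.single_smul, smul_eq_mul, mul_one]

namespace PolyhedralHypersurface

variable {ι : Type*} {m : ℕ} {X : PolyhedralHypersurface ι m}

/-- `π` maps the direction space of the cell `i` onto `ℝ^m`. -/
def IsTransversal (X : PolyhedralHypersurface ι m) (π : E (m + 2) →ₗ[ℝ] (Fin m → ℝ)) (i : ι) :
    Prop :=
  Submodule.map π (Submodule.span ℝ {X.normal i})ᗮ = ⊤

theorem exists_slicings (X : PolyhedralHypersurface ι m) (π : E (m + 2) →ₗ[ℝ] (Fin m → ℝ)) :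
    ∃ (τ : ι → E (m + 2)) (S : ι → (Fin m → ℝ) →ₗ[ℝ] E (m + 2)),
      ∀ i, X.IsTransversal π i → IsSlicing (X.normal i) π (τ i) (S i) := by
  have : ∀ i, ∃ (τ : E (m + 2)) (S : (Fin m → ℝ) →ₗ[ℝ] E (m + 2)),
      X.IsTransversal π i → IsSlicing (X.normal i) π τ S := by
    intro i
    by_cases h : X.IsTransversal π i
    · obtain ⟨τ, S, hS⟩ := exists_isSlicing (X.normal_ne_zero i) h
      exact ⟨τ, S, fun _ => hS⟩
    · exact ⟨0, 0, fun h' => absurd h' h⟩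
  choose τ S hS using this
  exact ⟨τ, S, hS⟩

theorem mem_vectorSpan_cell {i : ι} {d : E (m + 2)} :
    d ∈ vectorSpan ℝ (X.cell i) ↔ inner ℝ (X.normal i) d = 0 := by
  rw [X.vectorSpan_cell, Submodule.mem_orthogonal_singleton_iff_inner_right]

theorem inner_normal_of_mem_feasibleCone {i : ι} {p d : E (m + 2)} (hp : p ∈ X.cell i)
    (hd : d ∈ feasibleCone (X.cell i) p) : inner ℝ (X.normal i) d = 0 :=
  mem_vectorSpan_cell.1 (feasibleCone_subset_vectorSpan hp hd)

section RidgePoint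

variable {W : Set (E (m + 2))} {p : E (m + 2)} (h : X.IsRidgePoint W p) {i : ι}
  (hi : p ∈ X.cell i) {π : E (m + 2) →ₗ[ℝ] (Fin m → ℝ)} {e : Fin m → E (m + 2)}
  (hspan : Submodule.span ℝ (range e) = vectorSpan ℝ W) (he : ∀ j, π (e j) = Pi.single j 1)

include h hi hspan he

theorem IsRidgePoint.isTransversal : X.IsTransversal π i := by
  refine eq_top_iff.2 fun y _ => ?_
  obtain ⟨z, hz, rfl⟩ := exists_mem_span_map_eq he y
  refine ⟨z, ?_, rfl⟩
  rw [hspan, h.vectorSpan_eq i hi] at hz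
  rw [SetLike.mem_coe, Submodule.mem_orthogonal_singleton_iff_inner_right]
  exact inner_normal_of_mem_feasibleCone hi hz.1

variable {τ : E (m + 2)} {S : (Fin m → ℝ) →ₗ[ℝ] E (m + 2)} (hS : IsSlicing (X.normal i) π τ S)

include hS

/-- At a ridge point, the feasible directions of a cell are a multiple of `τ` up to directions of the
ridge. -/
theorem IsRidgePoint.exists_decomposition {d : E (m + 2)} (hd : inner ℝ (X.normal i) d = 0) :
    ∃ c : ℝ, ∃ z ∈ linealitySpace (X.convex_cell i) hi, d = c • τ + z := by
  obtain ⟨z, hz, hπz⟩ := exists_mem_span_map_eq he (π d)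
  rw [hspan, h.vectorSpan_eq i hi] at hz
  have hmem := hS.mem_span (d - z)
    (by rw [inner_sub_right, hd, inner_normal_of_mem_feasibleCone hi hz.1, sub_zero])
    (by rw [map_sub, hπz, sub_self])
  obtain ⟨c, hc⟩ := Submodule.mem_span_singleton.1 hmem
  exact ⟨c, z, hz, by rw [hc, sub_add_cancel]⟩

theorem IsRidgePoint.fst_notMem_linealitySpace : τ ∉ linealitySpace (X.convex_cell i) hi := by
  intro hτ
  rw [← h.vectorSpan_eq i hi, ← hspan] at hτ
  exact hS.ne_zero (eq_zero_of_mem_span_of_map_eq_zero he hτ hS.map_fst)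

theorem IsRidgePoint.mem_feasibleCone_or : τ ∈ feasibleCone (X.cell i) p ∨
    -τ ∈ feasibleCone (X.cell i) p := by
  obtain ⟨x, hx, hxL⟩ : ∃ x ∈ X.cell i, x - p ∉ linealitySpace (X.convex_cell i) hi := by
    by_contra! hall
    have h1 := Submodule.finrank_mono (vectorSpan_le_of_sub_mem hi hall)
    rw [X.finrank_cell, ← h.vectorSpan_eq i hi, h.isRidge.2.1] at h1
    omega
  have hxC := sub_mem_feasibleCone (p := p) hx
  obtain ⟨c, z, hz, hd⟩ := h.exists_decomposition hi hspan he hS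
    (inner_normal_of_mem_feasibleCone hi hxC)
  rw [hd, add_mem_feasibleCone_iff (X.convex_cell i) hi hz] at hxC
  rcases lt_trichotomy c 0 with hc | rfl | hc
  · right
    have := smul_mem_feasibleCone (inv_pos.2 (neg_pos.2 hc)) hxC
    rwa [smul_smul, show (-c)⁻¹ * c = -1 by rw [inv_neg, neg_mul, inv_mul_cancel₀ hc.ne],
      neg_one_smul] at this
  · rw [zero_smul, zero_add] at hd
    exact absurd (hd ▸ hz) hxL
  · left
    have := smul_mem_feasibleCone (inv_pos.2 hc) hxC
    rwa [smul_smul, inv_mul_cancel₀ hc.ne', one_smul] at this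

/-- The orientation sign that the fibrewise integration attaches to a cell at a ridge is the sign in
the balancing condition. -/
theorem IsRidgePoint.isCompatibleNormal_iff_eq (u : E (m + 2)) :
    IsCompatibleNormal (X.cell i) W e (X.normal i) u ↔
      u = -(endpointSign (X.cell i) τ p • X.normal i) := by
  have hD : 0 < det (Matrix.vecCons (X.normal i) (Matrix.vecCons τ e)) := by
    rw [← det_vecCons_vecCons_congr (b := e) (b' := fun j => S (Pi.single j 1))]
    · exact hS.det_pos
    · intro j
      refine hS.mem_span _ ?_ ?_
      · have hej : e j ∈ linealitySpace (X.convex_cell i) hi := by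
          rw [← h.vectorSpan_eq i hi, ← hspan]
          exact Submodule.subset_span ⟨j, rfl⟩
        rw [inner_sub_right, hS.inner_section, inner_normal_of_mem_feasibleCone hi hej.1, sub_zero]
      · rw [map_sub, hS.map_section, he, sub_self]
  have hnot : ¬(τ ∈ feasibleCone (X.cell i) p ∧ -τ ∈ feasibleCone (X.cell i) p) :=
    h.fst_notMem_linealitySpace hi hspan he hS
  -- with respect to the sign `σ` for which `σ τ` points into the cell, `u` has to be `σ v`
  have main : ∀ σ : ℝ, (σ = 1 ∨ σ = -1) → σ • τ ∈ feasibleCone (X.cell i) p →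
      (-σ) • τ ∉ feasibleCone (X.cell i) p →
      (IsCompatibleNormal (X.cell i) W e (X.normal i) u ↔ u = σ • X.normal i) := by
    intro σ hσ hσC hσC'
    have hσσ : σ * σ = 1 := by rcases hσ with rfl | rfl <;> norm_num
    rw [h.isCompatibleNormal_iff hi hspan]
    constructor
    · rintro ⟨hu, k, hk, hdet⟩
      obtain ⟨c, z, hz, rfl⟩ := h.exists_decomposition hi hspan he hS
        (inner_normal_of_mem_feasibleCone hi hk)
      rw [add_mem_feasibleCone_iff (X.convex_cell i) hi hz] at hk
      rw [← h.vectorSpan_eq i hi, ← hspan] at hz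
      rw [det_vecCons_vecCons_add_of_mem_span _ _ hz, det_vecCons_vecCons_smul] at hdet
      have hc : 0 ≤ σ * c := by
        by_contra! hneg
        have := smul_mem_feasibleCone (inv_pos.2 (neg_pos.2 hneg)) hk
        rw [smul_smul, (inv_mul_eq_iff_eq_mul₀ (neg_pos.2 hneg).ne').2
          (show c = -(σ * c) * -σ by linear_combination -c * hσσ)] at this
        exact hσC' this
      rcases hσ with rfl | rfl <;> rcases hu with rfl | rfl
      · simp
      · rw [det_vecCons_neg] at hdet
        nlinarith
      · nlinarith
      · simp
    · rintro rfl
      refine ⟨?_, σ • τ, hσC, ?_⟩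
      · rcases hσ with rfl | rfl <;> simp
      · rw [det_vecCons_vecCons_smul, det_vecCons_smul, ← mul_assoc, hσσ, one_mul]
        exact hD
  rcases h.mem_feasibleCone_or hi hspan he hS with hτ | hτ
  · have hτ' : -τ ∉ feasibleCone (X.cell i) p := fun h' => hnot ⟨hτ, h'⟩
    have := main 1 (Or.inl rfl) (by simpa using hτ) (by simpa using hτ')
    simpa [endpointSign, hi, hτ, hτ'] using this
  · have hτ' : τ ∉ feasibleCone (X.cell i) p := fun h' => hnot ⟨h', hτ⟩
    have := main (-1) (Or.inr rfl) (by simpa using hτ) (by simpa using hτ')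
    simpa [endpointSign, hi, hτ, hτ'] using this

/-- Near a ridge point, the boundary of a cell is the ridge. -/
theorem IsRidgePoint.eventually_endpointSign : ∀ᶠ p' in 𝓝 p,
    (p' - p ∈ Submodule.span ℝ (range e) →
      endpointSign (X.cell i) τ p' = endpointSign (X.cell i) τ p) ∧
    (p' - p ∉ Submodule.span ℝ (range e) → endpointSign (X.cell i) τ p' = 0) := by
  have hev := (X.isPolyhedron_cell i).eventually_mem_iff hi
  have hconv := X.convex_cell i
  have hspanL : Submodule.span ℝ (range e) = linealitySpace hconv hi := by
    rw [hspan, h.vectorSpan_eq i hi]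
  rw [hspanL]
  filter_upwards [eventually_eventually_nhds.2 hev] with p' hp'
  have hp'0 := hp'.self_of_nhds
  have hlim : ∀ d : E (m + 2), ∀ᶠ ε : ℝ in 𝓝 0,
      p' + ε • d ∈ X.cell i ↔ p' + ε • d - p ∈ feasibleCone (X.cell i) p := by
    intro d
    have hc : ContinuousAt (fun t : ℝ => p' + t • d) 0 := by fun_prop
    refine hc.eventually (p := fun x => x ∈ X.cell i ↔ x - p ∈ feasibleCone (X.cell i) p) ?_
    simpa using hp'
  constructor
  · intro hz
    have hmem : p' ∈ X.cell i := hp'0.2 hz.1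
    have hcone : ∀ d, d ∈ feasibleCone (X.cell i) p' ↔ d ∈ feasibleCone (X.cell i) p := by
      intro d
      have hiff : ∀ ε : ℝ, 0 < ε → (p' + ε • d - p ∈ feasibleCone (X.cell i) p ↔
          d ∈ feasibleCone (X.cell i) p) := by
        intro ε hε
        rw [add_sub_right_comm, add_comm (p' - p), add_mem_feasibleCone_iff hconv hi hz]
        refine ⟨fun h1 => ?_, smul_mem_feasibleCone hε⟩
        have := smul_mem_feasibleCone (inv_pos.2 hε) h1
        rwa [smul_smul, inv_mul_cancel₀ hε.ne', one_smul] at this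
      constructor
      · rintro ⟨δ, hδ, hδmem⟩
        obtain ⟨ε, hε, hε0, hεδ⟩ := (((hlim d).filter_mono nhdsWithin_le_nhds).and
          (Ioo_mem_nhdsGT hδ)).exists
        refine (hiff ε hε0).1 (hε.1 ?_)
        convert hconv hmem hδmem (a := 1 - ε / δ) (b := ε / δ)
          (by rw [sub_nonneg, div_le_one hδ]; exact hεδ.le) (by positivity) (by ring) using 1
        match_scalars <;> field_simp
        ring
      · intro hd
        obtain ⟨ε, hε, hε0⟩ := (((hlim d).filter_mono nhdsWithin_le_nhds).and
          (self_mem_nhdsWithin (s := Ioi (0 : ℝ)))).exists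
        exact ⟨ε, hε0, hε.2 ((hiff ε hε0).2 hd)⟩
    exact endpointSign_congr (by simp [hmem, hi]) (hcone _) (hcone _)
  · intro hz
    by_cases hmem : p' ∈ X.cell i
    swap
    · exact endpointSign_of_notMem hmem
    have hC : p' - p ∈ feasibleCone (X.cell i) p := hp'0.1 hmem
    obtain ⟨c, z, hzL, hd⟩ := h.exists_decomposition hi hspan he hS
      (inner_normal_of_mem_feasibleCone hi hC)
    rw [hd, add_mem_feasibleCone_iff hconv hi hzL] at hC
    have hc0 : c ≠ 0 := by
      rintro rfl
      rw [zero_smul, zero_add] at hd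
      exact hz (hd ▸ hzL)
    -- a small multiple of `τ` does not change the sign of the coefficient `c`
    have hsmall : ∀ᶠ ε : ℝ in 𝓝 0, (c + ε) • τ ∈ feasibleCone (X.cell i) p := by
      have hcont : ContinuousAt (fun ε : ℝ => (c + ε) / c) 0 := by fun_prop
      have hpos : ∀ᶠ ε : ℝ in 𝓝 0, 0 < (c + ε) / c := by
        refine hcont.eventually_mem (lt_mem_nhds ?_)
        simp [hc0]
      filter_upwards [hpos] with ε hε
      have := smul_mem_feasibleCone hε hC
      rwa [smul_smul, div_mul_cancel₀ _ hc0] at this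
    have hall : ∀ᶠ ε : ℝ in 𝓝 0, p' + ε • τ ∈ X.cell i := by
      filter_upwards [hsmall, hlim τ] with ε h1 h2
      rw [h2, add_sub_right_comm, hd, add_right_comm, ← add_smul,
        add_mem_feasibleCone_iff hconv hi hzL]
      exact h1
    refine endpointSign_of_mem_linealitySpace hconv hmem ⟨?_, ?_⟩
    · obtain ⟨ε, hε, hε0⟩ := ((hall.filter_mono nhdsWithin_le_nhds).and
        (self_mem_nhdsWithin (s := Ioi (0 : ℝ)))).exists
      exact ⟨ε, hε0, hε⟩
    · obtain ⟨ε, hε, hε0⟩ := ((hall.filter_mono nhdsWithin_le_nhds).and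
        (self_mem_nhdsWithin (s := Iio (0 : ℝ)))).exists
      refine ⟨-ε, neg_pos.2 hε0, ?_⟩
      rwa [neg_smul_neg]

end RidgePoint

end PolyhedralHypersurface

namespace PolyhedralHypersurface

variable {ι : Type*} [Fintype ι] {m : ℕ} (X : PolyhedralHypersurface ι m)

/-! ### The boundary of the current, fibre by fibre -/

open Classical in
/-- The sum of the normal vectors of the cells that end at `p` in the slices by the fibres of `π`,
with the signs in which `p` enters the boundary of these slices. -/
noncomputable def vertexSum (π : E (m + 2) →ₗ[ℝ] (Fin m → ℝ)) (τ : ι → E (m + 2))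
    (p : E (m + 2)) : E (m + 2) :=
  ∑ i with X.IsTransversal π i, endpointSign (X.cell i) (τ i) p • X.normal i

variable {X} {π : E (m + 2) →ₗ[ℝ] (Fin m → ℝ)} {τ : ι → E (m + 2)}
  {S : ι → (Fin m → ℝ) →ₗ[ℝ] E (m + 2)}

open Classical in
theorem current_dForm_eq_integral_vertexSum
    (hS : ∀ i, X.IsTransversal π i → IsSlicing (X.normal i) π (τ i) (S i))
    (β : E (m + 2) [⋀^Fin (m + 1)]→L[ℝ] ℝ) (φ : Test (E (m + 2)) ℝ) :
    X.current (dForm _ _ _ (scalarForm (tensorCovector (pullbackVolume π) β) φ)) =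
      (-1 : ℝ) ^ (m + 1) *
        ∫ y, ∑ᶠ p, if π p = y then φ p * wedgePairing β (X.vertexSum π τ p) else 0 := by
  rw [current_dForm_scalarForm]
  congr 1
  rw [← Finset.sum_filter_add_sum_filter_not Finset.univ (X.IsTransversal π), add_eq_left.2]
  swap
  · refine Finset.sum_eq_zero fun i hi => ?_
    rw [X.integral_cell_eq_zero i (Finset.mem_filter.1 hi).2, mul_zero]
  have hF := fun i (hi : i ∈ Finset.univ.filter (X.IsTransversal π)) =>
    X.integral_cell_eq_integral_fiber i (hS i (Finset.mem_filter.1 hi).2) φ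
  have h1 : ∀ i ∈ Finset.univ.filter (X.IsTransversal π), (wedgePairing β (X.normal i) *
        ∫ x in X.cell i, ContinuousAlternatingMap.alternatizeUncurryFin
          ((fderiv ℝ φ x).smulRight (pullbackVolume π)) (orientedFrame (X.normal i))
          ∂(Measure.euclideanHausdorffMeasure (m + 1))) =
      ∫ y, ∑ᶠ p, wedgePairing β (X.normal i) * fiberTerm (X.cell i) π (τ i) φ y p := by
    intro i hi
    rw [(hF i hi).2.2, ← integral_const_mul]
    congr 1
    funext y
    exact mul_finsum _ _
  have h2 : ∀ i ∈ Finset.univ.filter (X.IsTransversal π), Integrable fun y =>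
      ∑ᶠ p, wedgePairing β (X.normal i) * fiberTerm (X.cell i) π (τ i) φ y p := by
    intro i hi
    exact ((hF i hi).2.1.const_mul _).congr (ae_of_all _ fun y => mul_finsum _ _)
  rw [Finset.sum_congr rfl h1, ← integral_finsetSum _ h2]
  congr 1
  funext y
  rw [← finsum_sum_comm]
  · congr 1
    funext p
    simp only [fiberTerm]
    split_ifs with h
    · rw [vertexSum, map_sum, Finset.mul_sum]
      refine Finset.sum_congr rfl fun i _ => ?_
      rw [map_smul, smul_eq_mul]
      ring
    · simp
  · intro i hi
    refine ((hF i hi).1 y).subset fun p hp => ?_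
    exact right_ne_zero_of_mul hp

open Classical in
/-- At a point of a ridge that projects onto `ℝ^m`, the vertex sum is minus the sum that occurs in
the balancing condition. -/
theorem IsRidgePoint.vertexSum_eq {W : Set (E (m + 2))} {p : E (m + 2)} (h : X.IsRidgePoint W p)
    {e : Fin m → E (m + 2)} (hspan : Submodule.span ℝ (range e) = vectorSpan ℝ W)
    (he : ∀ j, π (e j) = Pi.single j 1)
    (hS : ∀ i, X.IsTransversal π i → IsSlicing (X.normal i) π (τ i) (S i)) {u : ι → E (m + 2)}
    (hu : ∀ i, W ⊆ X.cell i → IsCompatibleNormal (X.cell i) W e (X.normal i) (u i)) :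
    X.vertexSum π τ p = -∑ i with W ⊆ X.cell i, u i := by
  rw [vertexSum, ← Finset.sum_neg_distrib]
  symm
  refine Finset.sum_subset_zero_on_sdiff ?_ ?_ ?_
  · intro i hi
    have hip := (h.subset_cell_iff i).1 (Finset.mem_filter.1 hi).2
    exact Finset.mem_filter.2 ⟨Finset.mem_univ _, h.isTransversal hip hspan he⟩
  · intro i hi
    have hip : p ∉ X.cell i := fun hp => (Finset.mem_sdiff.1 hi).2
      (Finset.mem_filter.2 ⟨Finset.mem_univ _, (h.subset_cell_iff i).2 hp⟩)
    rw [endpointSign_of_notMem hip, zero_smul]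
  · intro i hi
    have hiW := (Finset.mem_filter.1 hi).2
    have hip := (h.subset_cell_iff i).1 hiW
    have := (h.isCompatibleNormal_iff_eq hip hspan he
      (hS i (h.isTransversal hip hspan he)) (u i)).1 (hu i hiW)
    rw [this, neg_neg]

open Classical in
theorem Balanced.vertexSum_eq_zero_of_isRidgePoint (hX : X.Balanced) {W : Set (E (m + 2))}
    {p : E (m + 2)} (h : X.IsRidgePoint W p)
    {e : Fin m → E (m + 2)} (hspan : Submodule.span ℝ (range e) = vectorSpan ℝ W)
    (he : ∀ j, π (e j) = Pi.single j 1)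
    (hS : ∀ i, X.IsTransversal π i → IsSlicing (X.normal i) π (τ i) (S i)) :
    X.vertexSum π τ p = 0 := by
  have hli : LinearIndependent ℝ e := by
    refine LinearIndependent.of_comp π ?_
    have : π ∘ e = Pi.basisFun ℝ (Fin m) := by
      funext j
      simp [he]
    rw [this]
    exact (Pi.basisFun ℝ (Fin m)).linearIndependent
  have hu : ∀ i, W ⊆ X.cell i → IsCompatibleNormal (X.cell i) W e (X.normal i)
      (-(endpointSign (X.cell i) (τ i) p • X.normal i)) := by
    intro i hiW
    have hip := (h.subset_cell_iff i).1 hiW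
    exact (h.isCompatibleNormal_iff_eq hip hspan he
      (hS i (h.isTransversal hip hspan he)) _).2 rfl
  rw [h.vertexSum_eq hspan he hS hu]
  have := hX W h.isRidge e hli hspan _ hu
  exact neg_eq_zero.2 this

/-- A fibre of `π` that meets only faces projecting onto `ℝ^m` leaves a cell only at ridges. -/
theorem Balanced.vertexSum_eq_zero (hX : X.Balanced)
    (hS : ∀ i, X.IsTransversal π i → IsSlicing (X.normal i) π (τ i) (S i)) {p : E (m + 2)}
    (hp : ∀ (i : ι) (hi : p ∈ X.cell i),
      Submodule.map π (linealitySpace (X.convex_cell i) hi) = ⊤) :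
    X.vertexSum π τ p = 0 := by
  classical
  by_cases hex : ∃ (i : ι) (hi : p ∈ X.cell i), X.IsTransversal π i ∧
      τ i ∉ linealitySpace (X.convex_cell i) hi
  swap
  · push Not at hex
    refine Finset.sum_eq_zero fun i hi => ?_
    have ht := (Finset.mem_filter.1 hi).2
    by_cases hip : p ∈ X.cell i
    · rw [endpointSign_of_mem_linealitySpace (X.convex_cell i) hip (hex i hip ht), zero_smul]
    · rw [endpointSign_of_notMem hip, zero_smul]
  obtain ⟨i, hi, ht, hτ⟩ := hex
  set L := linealitySpace (X.convex_cell i) hi with hL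
  have hle : L ≤ vectorSpan ℝ (X.cell i) := fun d hd => feasibleCone_subset_vectorSpan hi hd.1
  have hlt : L < vectorSpan ℝ (X.cell i) := by
    refine lt_of_le_of_ne hle fun heq => hτ ?_
    rw [heq]
    exact mem_vectorSpan_cell.2 (hS i ht).inner_fst
  have h1 := Submodule.finrank_lt_finrank_of_lt hlt
  rw [X.finrank_cell] at h1
  have h2 := Submodule.finrank_map_le π L
  rw [hp i hi, finrank_top, Module.finrank_fin_fun] at h2
  have hdim : finrank ℝ L = m := by omega
  obtain ⟨W, hW⟩ := exists_isRidgePoint_of_finrank hi hdim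
  have hex : ∀ j : Fin m, ∃ d ∈ L, π d = Pi.single j 1 := fun j => by
    have : Pi.single j 1 ∈ Submodule.map π L := by rw [hp i hi]; trivial
    exact this
  choose e heL he using hex
  refine hX.vertexSum_eq_zero_of_isRidgePoint hW (e := e) ?_ he hS
  rw [hW.vectorSpan_eq i hi]
  refine Submodule.eq_of_le_of_finrank_le (Submodule.span_le.2 ?_) ?_
  · rintro _ ⟨j, rfl⟩
    exact heL j
  · have h3 := Submodule.finrank_map_le π (Submodule.span ℝ (range e))
    have h4 : Submodule.map π (Submodule.span ℝ (range e)) = ⊤ := by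
      refine eq_top_iff.2 fun y _ => ?_
      obtain ⟨z, hz, rfl⟩ := exists_mem_span_map_eq he y
      exact ⟨z, hz, rfl⟩
    rw [h4, finrank_top, Module.finrank_fin_fun] at h3
    exact hdim.le.trans h3

theorem Balanced.d_current_eq_zero (hX : X.Balanced) : X.current.d = 0 := by
  classical
  rw [d_current_eq_zero_iff]
  intro α
  rw [testForm_eq_sum α]
  simp only [map_smul, map_sum]
  rw [Finset.sum_eq_zero, smul_zero]
  refine fun f _ => Finset.sum_eq_zero fun g _ => ?_
  obtain ⟨τ, S, hS⟩ := X.exists_slicings (coordProj f)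
  rw [current_dForm_eq_integral_vertexSum hS, integral_eq_zero_of_ae, mul_zero]
  have hgen : ∀ᵐ y, ∀ i, ∀ (p : E (m + 2)) (hp : p ∈ X.cell i), coordProj f p = y →
      Submodule.map (coordProj f) (linealitySpace (X.convex_cell i) hp) = ⊤ :=
    ae_all_iff.2 fun i => (X.isPolyhedron_cell i).ae_map_linealitySpace (coordProj f)
  filter_upwards [hgen] with y hy
  refine finsum_eq_zero_of_forall_eq_zero fun p => ?_
  split_ifs with h
  · rw [hX.vertexSum_eq_zero hS fun i hi => hy i p hi h, map_zero, mul_zero]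
  · rfl

/-- Near a relative interior point of a ridge, the vertex sum is constant on the ridge and vanishes
elsewhere. -/
theorem IsRidgePoint.eventually_vertexSum {W : Set (E (m + 2))} {p : E (m + 2)}
    (h : X.IsRidgePoint W p) {e : Fin m → E (m + 2)}
    (hspan : Submodule.span ℝ (range e) = vectorSpan ℝ W) (he : ∀ j, π (e j) = Pi.single j 1)
    (hS : ∀ i, X.IsTransversal π i → IsSlicing (X.normal i) π (τ i) (S i)) :
    ∀ᶠ p' in 𝓝 p,
      (p' - p ∈ Submodule.span ℝ (range e) → X.vertexSum π τ p' = X.vertexSum π τ p) ∧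
      (p' - p ∉ Submodule.span ℝ (range e) → X.vertexSum π τ p' = 0) := by
  classical
  have key : ∀ᶠ p' in 𝓝 p, ∀ i, X.IsTransversal π i →
      (p' - p ∈ Submodule.span ℝ (range e) →
        endpointSign (X.cell i) (τ i) p' = endpointSign (X.cell i) (τ i) p) ∧
      (p' - p ∉ Submodule.span ℝ (range e) → endpointSign (X.cell i) (τ i) p' = 0) := by
    rw [Filter.eventually_all]
    intro i
    by_cases hi : p ∈ X.cell i
    · filter_upwards [h.eventually_endpointSign hi hspan he
        (hS i (h.isTransversal hi hspan he))] with p' hp' _ using hp'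
    · filter_upwards [(X.isPolyhedron_cell i).isClosed.isOpen_compl.mem_nhds hi] with p' hp' _
      rw [endpointSign_of_notMem hi, endpointSign_of_notMem hp']
      simp
  filter_upwards [key] with p' hp'
  constructor
  · intro hz
    refine Finset.sum_congr rfl fun i hi => ?_
    rw [(hp' i (Finset.mem_filter.1 hi).2).1 hz]
  · intro hz
    refine Finset.sum_eq_zero fun i hi => ?_
    rw [(hp' i (Finset.mem_filter.1 hi).2).2 hz, zero_smul]

theorem balanced_of_d_current_eq_zero (hX : X.current.d = 0) : X.Balanced := by
  classical
  rw [d_current_eq_zero_iff] at hX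
  intro W hW e hli hspan u hu
  obtain ⟨p, hp⟩ := hW.exists_isRidgePoint
  -- a projection for which `e` is the lift of the standard basis
  let σ : (Fin m → ℝ) →ₗ[ℝ] E (m + 2) := (Pi.basisFun ℝ (Fin m)).constr ℝ e
  have hσe : ∀ j, σ (Pi.single j 1) = e j := fun j => by
    rw [← Pi.basisFun_apply]
    exact (Pi.basisFun ℝ (Fin m)).constr_basis ℝ e j
  have hσrange : ∀ y, σ y ∈ Submodule.span ℝ (range e) := fun y => by
    rw [← (Pi.basisFun ℝ (Fin m)).constr_range (S := ℝ)]
    exact ⟨y, rfl⟩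
  have hσker : LinearMap.ker σ = ⊥ := by
    refine LinearMap.ker_eq_bot.2 ?_
    exact (Pi.basisFun ℝ (Fin m)).injective_constr_of_linearIndependent hli
  obtain ⟨π, hπ⟩ := σ.exists_leftInverse_of_injective hσker
  have hπσ : ∀ y, π (σ y) = y := fun y => congrArg (fun f => f y) hπ
  have he : ∀ j, π (e j) = Pi.single j 1 := fun j => by rw [← hσe, hπσ]
  obtain ⟨τ, S, hS⟩ := X.exists_slicings π
  suffices hN : X.vertexSum π τ p = 0 by
    have := hp.vertexSum_eq hspan he hS hu
    rw [hN] at this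
    simpa using this
  refine eq_zero_of_wedgePairing_eq_zero fun β => ?_
  -- a test function concentrated near `p`
  obtain ⟨r, hr, hball⟩ := Metric.eventually_nhds_iff_ball.1
    (hp.eventually_vertexSum hspan he hS)
  let b : ContDiffBump p := ⟨r / 2, r, by positivity, by linarith⟩
  let φ : Test (E (m + 2)) ℝ := ⟨b, b.contDiff, b.hasCompactSupport, subset_univ _⟩
  have hφ : ∀ x, φ x = b x := fun x => rfl
  have hφsupp : ∀ x, φ x ≠ 0 → x ∈ Metric.ball p r := fun x hx => by
    rw [← b.support_eq]
    exact hx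
  let s : (Fin m → ℝ) → E (m + 2) := fun y => p + σ (y - π p)
  have hπs : ∀ y, π (s y) = y := fun y => by
    simp only [s, map_add, hπσ, add_sub_cancel]
  have hsum : ∀ y, (∑ᶠ p', if π p' = y then φ p' * wedgePairing β (X.vertexSum π τ p') else 0) =
      φ (s y) * wedgePairing β (X.vertexSum π τ p) := by
    intro y
    rw [finsum_eq_single _ (s y), if_pos (hπs y)]
    · by_cases h0 : φ (s y) = 0
      · rw [h0, zero_mul, zero_mul]
      · rw [(hball _ (hφsupp _ h0)).1]
        simpa [s] using! hσrange (y - π p)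
    · intro p' hne
      split_ifs with hy
      · by_cases h0 : φ p' = 0
        · rw [h0, zero_mul]
        · rw [(hball _ (hφsupp _ h0)).2, map_zero, mul_zero]
          intro hmem
          refine hne (sub_eq_zero.1 (eq_zero_of_mem_span_of_map_eq_zero he ?_ ?_))
          · have := Submodule.sub_mem _ hmem (hσrange (y - π p))
            rwa [sub_sub] at this
          · rw [map_sub, hπs, hy, sub_self]
      · rfl
  have hcur := hX (scalarForm (tensorCovector (pullbackVolume π) β) φ)
  rw [current_dForm_eq_integral_vertexSum hS] at hcur
  simp only [hsum] at hcur
  rw [integral_mul_const] at hcur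
  have hpos : 0 < ∫ y, φ (s y) := by
    have hσemb := LinearMap.isClosedEmbedding_of_injective hσker
    have hsemb : Topology.IsClosedEmbedding s :=
      (Homeomorph.addLeft p).isClosedEmbedding.comp
        (hσemb.comp (Homeomorph.subRight (π p)).isClosedEmbedding)
    refine Continuous.integral_pos_of_hasCompactSupport_nonneg_nonzero (x := π p)
      (b.continuous.comp hsemb.continuous) (b.hasCompactSupport.comp_isClosedEmbedding hsemb)
      (fun y => b.nonneg) ?_
    have : s (π p) = p := by simp [s]
    rw [this, hφ, b.one_of_mem_closedBall (Metric.mem_closedBall_self b.rIn_pos.le)]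
    exact one_ne_zero
  have h1 : (-1 : ℝ) ^ (m + 1) ≠ 0 := pow_ne_zero _ (by norm_num)
  exact (mul_eq_zero.1 ((mul_eq_zero.1 hcur).resolve_left h1)).resolve_left hpos.ne'

theorem d_current_eq_zero_iff_balanced (X : PolyhedralHypersurface ι m) :
    X.current.d = 0 ↔ X.Balanced :=
  ⟨balanced_of_d_current_eq_zero, Balanced.d_current_eq_zero⟩

end PolyhedralHypersurface

end SuperCurrent

theorem mainTheorem8 (m : ℕ) :
    (∀ (ι : Type) [Fintype ι] (X : SuperCurrent.PolyhedralHypersurface ι m),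
      X.current.d = 0 ↔ X.Balanced) ∧
    (∀ f : SuperCurrent.TropicalPolynomial (m + 2),
      f.hypersurface.current.d = 0 ↔ f.hypersurface.Balanced) :=
  ⟨fun _ _ X => X.d_current_eq_zero_iff_balanced,
    fun f => f.hypersurface.d_current_eq_zero_iff_balanced⟩
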